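/- Conventions. All C*-algebras are unital, complex and nonzero. For such $\mathfrak A$, let $\mathfrak{sa}(\mathfrak A)$ be its self-adjoint part and $\mathscr S(\mathfrak A)$ its state space. A \emph{Leibniz quantum compact metric space} $(\mathfrak A,\mathsf L)$ is such an algebra with a seminorm $\mathsf L$ defined on a dense subspace of $\mathfrak{sa}(\mathfrak A)$ (and set to $\infty$ off it) such that: $\mathsf L(a)=0$ if and only if $a\in\mathbb R1_{\mathfrak A}$; the Monge-Kantorovich metric $\mathsf{mk}_{\mathsf L}(\varphi,\psi)=\sup\{|\varphi(a)-\psi(a)| : a\in\mathfrak{sa}(\mathfrak A),\ \mathsf L(a)\le 1\}$ is finite and metrizes the weak* topology of $\mathscr S(\mathfrak A)$; $\mathsf L$ is lower semicontinuous for the norm; and for all $a,b$ in its domain, $\mathsf L\left(\frac{ab+ba}2\right)$ and $\mathsf L\left(\frac{ab-ba}{2i}\right)$ are at most $\|a\|\mathsf L(b)+\|b\|\mathsf L(a)$. An \emph{isometric isomorphism} from $(\mathfrak A,\mathsf L_{\mathfrak A})$ to $(\mathfrak B,\mathsf L_{\mathfrak B})$ is a *-isomorphism $h:\mathfrak A\to\mathfrak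 B$ with $\mathsf L_{\mathfrak B}\circ h=\mathsf L_{\mathfrak A}$ on $\mathfrak{sa}(\mathfrak A)$. A \emph{tunnel} $\tau=(\mathfrak D,\mathsf L_{\mathfrak D},\pi_1,\pi_2)$ from $(\mathfrak A_1,\mathsf L_1)$ to $(\mathfrak A_2,\mathsf L_2)$ is a Leibniz quantum compact metric space $(\mathfrak D,\mathsf L_{\mathfrak D})$ with unital *-epimorphisms $\pi_j:\mathfrak D\to\mathfrak A_j$ such that $\mathsf L_j(a)=\inf\{\mathsf L_{\mathfrak D}(d) : d\in\mathfrak{sa}(\mathfrak D),\ \pi_j(d)=a\}$ for all $a\in\mathfrak{sa}(\mathfrak A_j)$, $j=1,2$. Write $\pi_j^*(\varphi)=\varphi\circ\pi_j$, and let $\mathrm{Haus}$ be the Hausdorff distance for $\mathsf{mk}_{\mathsf L_{\mathfrak D}}$. The \emph{length} $\lambda(\tau)$ is the maximum of the \emph{reach} $\mathrm{Haus}\big(\pi_1^*\mathscr S(\mathfrak A_1),\pi_2^*\mathscr S(\mathfrak A_2)\big)$ and the \emph{depth} $\mathrm{Haus}\big(\mathscr S(\mathfrak D),\overline{\mathrm{co}}(\pi_1^*\mathscr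 S(\mathfrak A_1)\cup\pi_2^*\mathscr S(\mathfrak A_2))\big)$, where $\overline{\mathrm{co}}$ is the weak* closed convex hull. Let $\mathcal C$ be a nonempty class of Leibniz quantum compact metric spaces and $\mathcal T$ a class of tunnels. A \emph{$\mathcal T$-journey} from $A\in\mathcal C$ to $B\in\mathcal C$ is a finite sequence of tunnels $\tau_j\in\mathcal T$ from $A_j$ to $A_{j+1}$, $1\le j\le n$, $n\ge1$, with all $A_j\in\mathcal C$, $A_1=A$ and $A_{n+1}=B$; its length is $\sum_{j=1}^n\lambda(\tau_j)$. The class $\mathcal T$ is \emph{$\mathcal C$-compatible} if: (i) $(\mathfrak D,\mathsf L_{\mathfrak D},\pi,\rho)\in\mathcal T$ implies $(\mathfrak D,\mathsf L_{\mathfrak D},\rho,\pi)\in\mathcal T$; (ii) any two elements of $\mathcal C$ are joined by a $\mathcal T$-journey; (iii) for every isometric isomorphism $h$ between elements $(\mathfrak A,\mathsf L_{\mathfrak A})$ and $(\mathfrak B,\mathsf L_{\mathfrak B})$ of $\mathcal C$, the tunnels $(\mathfrak A,\mathsf L_{\mathfrak A},\mathrm{id},h)$ and $(\mathfrak B,\mathsf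 L_{\mathfrak B},\mathrm{id},h^{-1})$ are in $\mathcal T$; (iv) every tunnel in $\mathcal T$ goes from an element of $\mathcal C$ to an element of $\mathcal C$. The \emph{dual Gromov-Hausdorff $\mathcal T$-propinquity} $\Lambda^*_{\mathcal T}(A,B)$ is the infimum of the lengths of all $\mathcal T$-journeys from $A$ to $B$. \textbf{Theorem.} Let $\mathcal C$ be a nonempty class of Leibniz quantum compact metric spaces and let $\mathcal T$ be a $\mathcal C$-compatible class of tunnels. Then for all $A_1,A_2,A_3\in\mathcal C$: \begin{enumerate} \item $\Lambda^*_{\mathcal T}(A_1,A_2)\in[0,\infty)$; \item $\Lambda^*_{\mathcal T}(A_1,A_2)=\Lambda^*_{\mathcal T}(A_2,A_1)$; \item $\Lambda^*_{\mathcal T}(A_1,A_2)\le\Lambda^*_{\mathcal T}(A_1,A_3)+\Lambda^*_{\mathcal T}(A_3,A_2)$; \item $\Lambda^*_{\mathcal T}(A_1,A_2)=0$ if and only if there is an isometric isomorphism from $A_1$ to $A_2$. \end{enumerate} Hence $\Lambda^*_{\mathcal T}$ induces a metric on the set of isometric isomorphism classes of elements of $\mathcal C$. -/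

import Mathlib

open scoped ENNReal ComplexOrder

universe u

namespace Propinquity

section StateSpace

variable {A B : Type u} [CStarAlgebra A] [CStarAlgebra B]

/-- The Jordan product `(ab + ba) / 2` of two self-adjoint elements. -/
noncomputable def jordan (a b : selfAdjoint A) : selfAdjoint A :=
  ⟨(1 / 2 : ℂ) • ((a : A) * b + b * a), by
    have ha : star (a : A) = a := a.2
    have hb : star (b : A) = b := b.2
    rw [selfAdjoint.mem_iff]
    simp [star_smul, ha, hb, add_comm]⟩

/-- The Lie product `(ab - ba) / (2i)` of two self-adjoint elements. -/
noncomputable def lie (a b : selfAdjoint A) : selfAdjoint A :=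
  ⟨(1 / (2 * Complex.I) : ℂ) • ((a : A) * b - b * a), by
    have ha : star (a : A) = a := a.2
    have hb : star (b : A) = b := b.2
    rw [selfAdjoint.mem_iff]
    simp only [star_smul, star_sub, star_mul, ha, hb]
    rw [← neg_sub ((a : A) * b) (b * a), smul_neg, ← neg_smul]
    congr 1
    simp⟩

/-- The restriction of a unital *-morphism to self-adjoint parts. -/
def saMap (f : A →⋆ₐ[ℂ] B) (a : selfAdjoint A) : selfAdjoint B :=
  ⟨f a, by
    rw [selfAdjoint.mem_iff, ← map_star]
    exact congrArg f a.2⟩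

variable (A) in
/-- The state space: unital positive linear functionals. As a subtype of `WeakDual ℂ A`, it carries
the weak* topology. -/
abbrev State : Type u :=
  {φ : WeakDual ℂ A // φ 1 = 1 ∧ ∀ a : A, 0 ≤ φ (star a * a)}

open scoped CStarAlgebra in
/-- The map `φ ↦ φ ∘ π` from states of `B` to states of `A`, dual to a unital *-morphism
`π : A → B`. -/
noncomputable def State.pullback (π : A →⋆ₐ[ℂ] B) (φ : State B) : State A :=
  ⟨StrongDual.toWeakDual
      ((WeakDual.toStrongDual φ.1).comp (ContinuousLinearMap.mk π.toAlgHom.toLinearMap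
        (map_continuous π))), by
    refine ⟨?_, fun a => ?_⟩
    · change φ.1 (π 1) = 1
      rw [map_one]
      exact φ.2.1
    · change 0 ≤ φ.1 (π (star a * a))
      rw [map_mul, map_star]
      exact φ.2.2 _⟩

/-- The Monge-Kantorovich distance between two states, with values in `[0, ∞]`. -/
noncomputable def mkDist (L : selfAdjoint A → ℝ≥0∞) (φ ψ : State A) : ℝ≥0∞ :=
  ⨆ (a : selfAdjoint A) (_ : L a ≤ 1), ‖φ.1 (a : A) - ψ.1 (a : A)‖ₑ

/-- The extended (pseudo)metric structure on the state space given by the Monge-Kantorovich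
distance, with the topology which this distance induces. -/
@[reducible] noncomputable def mkSpace (L : selfAdjoint A → ℝ≥0∞) :
    PseudoEMetricSpace (State A) where
  edist := mkDist L
  edist_self φ := by simp [mkDist]
  edist_comm φ ψ := by
    unfold mkDist
    refine iSup_congr fun a => iSup_congr fun _ => ?_
    rw [← enorm_neg, neg_sub]
  edist_triangle φ ψ χ := by
    refine iSup₂_le fun a ha => ?_
    calc ‖φ.1 (a : A) - χ.1 (a : A)‖ₑ
        = ‖(φ.1 (a : A) - ψ.1 (a : A)) + (ψ.1 (a : A) - χ.1 (a : A))‖ₑ := by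
          rw [sub_add_sub_cancel]
      _ ≤ ‖φ.1 (a : A) - ψ.1 (a : A)‖ₑ + ‖ψ.1 (a : A) - χ.1 (a : A)‖ₑ := enorm_add_le _ _
      _ ≤ mkDist L φ ψ + mkDist L ψ χ :=
          add_le_add
            (le_iSup₂ (f := fun (a : selfAdjoint A) (_ : L a ≤ 1) =>
              ‖φ.1 (a : A) - ψ.1 (a : A)‖ₑ) a ha)
            (le_iSup₂ (f := fun (a : selfAdjoint A) (_ : L a ≤ 1) =>
              ‖ψ.1 (a : A) - χ.1 (a : A)‖ₑ) a ha)

/-- The Hausdorff distance on sets of states for the Monge-Kantorovich distance. -/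
noncomputable def mkHausdorff (L : selfAdjoint A → ℝ≥0∞) (S T : Set (State A)) : ℝ≥0∞ :=
  @Metric.hausdorffEDist _ (mkSpace L) S T

/-- `(A, L)` is a Lipschitz pair. A seminorm on a dense subspace of the self-adjoint part is
represented by its extension by `∞` off its domain, so that the domain is `{a | L a < ∞}`. -/
structure IsLipschitzPair (L : selfAdjoint A → ℝ≥0∞) : Prop where
  add_le : ∀ a b, L (a + b) ≤ L a + L b
  smul : ∀ (t : ℝ) (a), L (t • a) = ‖t‖ₑ * L a
  dense : Dense {a | L a < ∞}
  eq_zero_iff : ∀ a, L a = 0 ↔ ∃ t : ℝ, a = t • (1 : selfAdjoint A)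

/-- `L` is a Lip-norm: the Monge-Kantorovich distance is a finite metric
which induces the weak* topology of the state space. -/
structure IsLipNorm (L : selfAdjoint A → ℝ≥0∞) : Prop extends IsLipschitzPair L where
  finite : ∀ φ ψ : State A, mkDist L φ ψ < ∞
  metrizes : (mkSpace L).toUniformSpace.toTopologicalSpace =
    (inferInstance : TopologicalSpace (State A))

/-- The Leibniz property. It forces the domain of `L` to be closed under both products. -/
structure IsLeibniz (L : selfAdjoint A → ℝ≥0∞) : Prop where
  jordan_le : ∀ a b, L a < ∞ → L b < ∞ → L (jordan a b) ≤ ‖a‖ₑ * L b + ‖b‖ₑ * L a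
  lie_le : ∀ a b, L a < ∞ → L b < ∞ → L (lie a b) ≤ ‖a‖ₑ * L b + ‖b‖ₑ * L a

end StateSpace

/-- A Leibniz quantum compact metric space: a (nonzero) unital C*-algebra with a
lower semicontinuous Leibniz Lip-norm. -/
structure LeibnizQCMS : Type (u + 1) where
  carrier : Type u
  [cstar : CStarAlgebra carrier]
  [nontrivial : Nontrivial carrier]
  L : selfAdjoint carrier → ℝ≥0∞
  isLipNorm : IsLipNorm L
  isLeibniz : IsLeibniz L
  lsc : LowerSemicontinuous L

instance : CoeSort LeibnizQCMS.{u} (Type u) := ⟨LeibnizQCMS.carrier⟩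

attribute [instance] LeibnizQCMS.cstar LeibnizQCMS.nontrivial

/-- An isometric isomorphism: a *-isomorphism `h` with `L_B ∘ h = L_A`. -/
structure IsometricIso (A B : LeibnizQCMS.{u}) : Type u where
  toEquiv : A ≃⋆ₐ[ℂ] B
  map_L : ∀ a : selfAdjoint A, B.L (saMap (toEquiv : A →⋆ₐ[ℂ] B) a) = A.L a

namespace IsometricIso

variable {A B C : LeibnizQCMS.{u}}

def refl (A : LeibnizQCMS.{u}) : IsometricIso A A where
  toEquiv := StarAlgEquiv.refl ℂ A
  map_L _ := rfl

def symm (h : IsometricIso A B) : IsometricIso B A where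
  toEquiv := h.toEquiv.symm
  map_L b := by
    rw [← h.map_L]
    congr 1
    exact Subtype.ext (h.toEquiv.apply_symm_apply b)

def trans (h : IsometricIso A B) (k : IsometricIso B C) : IsometricIso A C where
  toEquiv := h.toEquiv.trans k.toEquiv
  map_L a := by
    rw [← h.map_L, ← k.map_L]
    rfl

end IsometricIso

/-- The relation of isometric isomorphism on a class of Leibniz quantum compact metric spaces. -/
def isoSetoid (𝒞 : Set LeibnizQCMS.{u}) : Setoid 𝒞 where
  r A B := Nonempty (IsometricIso A.1 B.1)
  iseqv :=
    { refl := fun A => ⟨IsometricIso.refl A.1⟩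
      symm := fun ⟨h⟩ => ⟨h.symm⟩
      trans := fun ⟨h⟩ ⟨k⟩ => ⟨h.trans k⟩ }

/-- A tunnel `(D, L_D, π₁, π₂)` from `A` to `B`: both maps are unital *-epimorphisms
along which the quotients of `L_D` are `L_A` and `L_B`. -/
structure Tunnel (A B : LeibnizQCMS.{u}) : Type (u + 1) where
  D : LeibnizQCMS.{u}
  π₁ : D →⋆ₐ[ℂ] A
  π₂ : D →⋆ₐ[ℂ] B
  surjective₁ : Function.Surjective π₁
  surjective₂ : Function.Surjective π₂
  quotient₁ : ∀ a : selfAdjoint A, A.L a = ⨅ (d : selfAdjoint D) (_ : saMap π₁ d = a), D.L d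
  quotient₂ : ∀ b : selfAdjoint B, B.L b = ⨅ (d : selfAdjoint D) (_ : saMap π₂ d = b), D.L d

namespace Tunnel

variable {A B : LeibnizQCMS.{u}}

/-- The reversed tunnel. -/
def reverse (τ : Tunnel A B) : Tunnel B A :=
  ⟨τ.D, τ.π₂, τ.π₁, τ.surjective₂, τ.surjective₁, τ.quotient₂, τ.quotient₁⟩

/-- The tunnel `(A, L_A, id, h)` given by an isometric isomorphism `h` from `A` to `B`. -/
def ofIso (h : IsometricIso A B) : Tunnel A B where
  D := A
  π₁ := StarAlgHom.id ℂ A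
  π₂ := (h.toEquiv : A →⋆ₐ[ℂ] B)
  surjective₁ := Function.surjective_id
  surjective₂ := h.toEquiv.surjective
  quotient₁ a := by
    have key : ∀ d : selfAdjoint A, saMap (StarAlgHom.id ℂ A) d = d := fun _ => rfl
    simp only [key, iInf_iInf_eq_left]
  quotient₂ b := by
    refine le_antisymm (le_iInf₂ ?_) ?_
    · rintro d rfl
      exact (h.map_L d).le
    · refine iInf₂_le_of_le (saMap (h.symm.toEquiv : B →⋆ₐ[ℂ] A) b) ?_ (h.symm.map_L b).le
      exact Subtype.ext (h.toEquiv.apply_symm_apply b)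

/-- The reach of a tunnel: the Hausdorff distance between the copies of the two state spaces. -/
noncomputable def reach (τ : Tunnel A B) : ℝ≥0∞ :=
  mkHausdorff τ.D.L (Set.range (State.pullback τ.π₁)) (Set.range (State.pullback τ.π₂))

/-- The states of `D` in the weak* closed convex hull of the copies of the two state spaces. -/
def hull (τ : Tunnel A B) : Set (State τ.D) :=
  {φ | φ.1 ∈ closedConvexHull ℝ ((fun ψ : State τ.D => ψ.1) ''
    (Set.range (State.pullback τ.π₁) ∪ Set.range (State.pullback τ.π₂)))}

/-- The depth of a tunnel: the Hausdorff distance between the state space of `D` and the closed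
convex hull of the copies of the two state spaces. -/
noncomputable def depth (τ : Tunnel A B) : ℝ≥0∞ :=
  mkHausdorff τ.D.L Set.univ τ.hull

/-- The length of a tunnel. -/
noncomputable def length (τ : Tunnel A B) : ℝ≥0∞ := max τ.reach τ.depth

end Tunnel

/-- A journey from `A` to `B`: a finite nonempty chain of tunnels in `𝒯`, each ending where the
next one starts, with all the endpoints in `𝒞`. -/
inductive Journey (𝒞 : Set LeibnizQCMS.{u}) (𝒯 : ∀ A B : LeibnizQCMS.{u}, Set (Tunnel A B)) :
    LeibnizQCMS.{u} → LeibnizQCMS.{u} → Type (u + 1)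
  | single {A B : LeibnizQCMS.{u}} (hA : A ∈ 𝒞) (hB : B ∈ 𝒞) (τ : Tunnel A B) (hτ : τ ∈ 𝒯 A B) :
      Journey 𝒞 𝒯 A B
  | cons {A B E : LeibnizQCMS.{u}} (hA : A ∈ 𝒞) (τ : Tunnel A B) (hτ : τ ∈ 𝒯 A B)
      (Υ : Journey 𝒞 𝒯 B E) : Journey 𝒞 𝒯 A E

/-- The length of a journey: the sum of the lengths of its tunnels. -/
noncomputable def Journey.length {𝒞 : Set LeibnizQCMS.{u}}
    {𝒯 : ∀ A B : LeibnizQCMS.{u}, Set (Tunnel A B)} :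
    ∀ {A B : LeibnizQCMS.{u}}, Journey 𝒞 𝒯 A B → ℝ≥0∞
  | _, _, .single _ _ τ _ => τ.length
  | _, _, .cons _ τ _ Υ => τ.length + Υ.length

/-- The class `𝒯` of tunnels is compatible with the class `𝒞`. -/
structure Compatible (𝒞 : Set LeibnizQCMS.{u})
    (𝒯 : ∀ A B : LeibnizQCMS.{u}, Set (Tunnel A B)) : Prop where
  reverse_mem : ∀ {A B} (τ : Tunnel A B), τ ∈ 𝒯 A B → τ.reverse ∈ 𝒯 B A
  connected : ∀ A ∈ 𝒞, ∀ B ∈ 𝒞, Nonempty (Journey 𝒞 𝒯 A B)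
  ofIso_mem : ∀ A ∈ 𝒞, ∀ B ∈ 𝒞, ∀ h : IsometricIso A B,
    Tunnel.ofIso h ∈ 𝒯 A B ∧ Tunnel.ofIso h.symm ∈ 𝒯 B A
  mem_of_mem : ∀ {A B} (τ : Tunnel A B), τ ∈ 𝒯 A B → A ∈ 𝒞 ∧ B ∈ 𝒞

/-- The dual Gromov-Hausdorff `𝒯`-propinquity, a priori with values in `[0, ∞]`. -/
noncomputable def propinquity (𝒞 : Set LeibnizQCMS.{u})
    (𝒯 : ∀ A B : LeibnizQCMS.{u}, Set (Tunnel A B)) (A B : LeibnizQCMS.{u}) : ℝ≥0∞ :=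
  ⨅ Υ : Journey 𝒞 𝒯 A B, Υ.length

end Propinquity

namespace Propinquity

open Filter Topology
open scoped NNReal

/-! ### States: positivity, norms, weak* compactness. -/

section States

variable {A : Type u} [CStarAlgebra A]

/-! Symmetry comes from reversing journeys and the triangle inequality from concatenating them.
Lengths are finite because a Lip-norm metrizes the weak* compact state space, which therefore has
finite diameter. An isometric isomorphism is itself a tunnel of length zero. The substance is that
distance zero produces an isometric isomorphism.

Join `a` and `b` when lifts through the tunnels of a journey connect them, with all seminorms at
most `l` and all norms at most `K`. The reach shows that the norms of `a` and `b` differ by at most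
`l` times the length (`Tunnel.enorm_saMap_π₂_le`), and reach and depth together bound the norms of
lifts (`Tunnel.enorm_lift_le`). These relations respect the linear structure and, by the Leibniz
property, the Jordan and Lie products.

Now take journeys with lengths tending to zero and pass to limits along an ultrafilter. Sets bounded
in both norm and seminorm are relatively compact (`cauchy_of_isLipNorm`), so every element of finite
seminorm acquires a partner, whose seminorm is no larger by lower semicontinuity. In the limit the
norm discrepancy vanishes, so partners are unique. The limit relation, complexified and closed up in
`A × B`, is a C*-algebra that projects isometrically onto both factors; composing one projection
with the inverse of the other gives the isomorphism. An ultrafilter makes all limits exist along the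
same sequence of journeys, with no diagonal extraction. -/

instance : CompleteSpace (selfAdjoint A) :=
  (isClosed_eq continuous_star continuous_id : IsClosed {x : A | star x = x}).completeSpace_coe

/-- A continuous functional of norm at most one which maps `1` to `1` is positive. -/
theorem nonneg_of_norm_le_one (f : StrongDual ℂ A) (hf : ‖f‖ ≤ 1) (h1 : f 1 = 1) (a : A) :
    0 ≤ f (star a * a) := by
  let _ := CStarAlgebra.spectralOrder A
  have := CStarAlgebra.spectralOrderedRing A
  have hb (x : A) : ‖f x‖ ≤ ‖x‖ := (f.le_opNorm x).trans (mul_le_of_le_one_left (norm_nonneg x) hf)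
  -- Compare `f` on `x + it`: its imaginary part shifts by `t`, while the squared norm is at most
  -- `‖x‖² + t²`. Validity for every real `t` forces `f x` to be real.
  have him (x : A) (hx : IsSelfAdjoint x) (t : ℝ) : ((f x).im + t) ^ 2 ≤ ‖x‖ ^ 2 + t ^ 2 := by
    have h := hb (x + (t * Complex.I) • 1)
    have e : star (x + (t * Complex.I) • (1 : A)) * (x + (t * Complex.I) • 1) =
        x * x + ((t ^ 2 : ℝ) : ℂ) • 1 := by
      simp only [star_add, star_smul, hx.star_eq, star_one, add_mul, mul_add, smul_mul_assoc,
        mul_smul_comm, one_mul, mul_one]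
      have : (starRingEnd ℂ) (t * Complex.I) = - (t * Complex.I) := by simp
      simp only [Complex.star_def, this, neg_smul]
      have : -(t * Complex.I) * (t * Complex.I) = ((t ^ 2 : ℝ) : ℂ) := by
        push_cast
        linear_combination (-(t : ℂ) ^ 2) * Complex.I_sq
      rw [← this]
      module
    have h2 : ‖x + (t * Complex.I) • (1 : A)‖ ^ 2 ≤ ‖x‖ ^ 2 + t ^ 2 := by
      rw [sq, ← CStarRing.norm_star_mul_self, e]
      refine (norm_add_le _ _).trans (add_le_add ?_ ?_)
      · exact (norm_mul_le _ _).trans (sq _).ge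
      · rw [norm_smul]
        rcases subsingleton_or_nontrivial A with h | h
        · simp [Subsingleton.elim (1 : A) 0, sq_nonneg]
        · simp
    have h3 : (f x).im + t = (f (x + (t * Complex.I) • 1)).im := by
      simp [h1]
    rw [h3]
    refine le_trans ?_ ((pow_le_pow_left₀ (norm_nonneg _) h 2).trans h2)
    rw [← sq_abs]
    exact pow_le_pow_left₀ (abs_nonneg _) (Complex.abs_im_le_norm _) 2
  have hre (x : A) (hx : IsSelfAdjoint x) : (f x).im = 0 := by
    by_contra hne
    -- This `t` makes the cross term equal to `2(‖x‖² + 1)`, which exceeds the available `‖x‖²`.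
    have := him x hx ((‖x‖ ^ 2 + 1) / (f x).im)
    have e : ((f x).im + (‖x‖ ^ 2 + 1) / (f x).im) ^ 2 =
        (f x).im ^ 2 + 2 * (‖x‖ ^ 2 + 1) + ((‖x‖ ^ 2 + 1) / (f x).im) ^ 2 := by
      field_simp
      ring
    nlinarith [sq_nonneg (f x).im, sq_nonneg ‖x‖]
  have hsa : IsSelfAdjoint (star a * a) := .star_mul_self a
  rw [Complex.nonneg_iff]
  refine ⟨?_, (hre _ hsa).symm⟩
  -- For positive `p`, `‖p‖ - p` has norm at most `‖p‖`; applying `f` gives `‖p‖ - Re f p ≤ ‖p‖`.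
  have hn : ‖algebraMap ℝ A ‖star a * a‖ - star a * a‖ ≤ ‖star a * a‖ := by
    refine (CStarAlgebra.norm_le_iff_le_algebraMap _ (norm_nonneg _) ?_).2 ?_
    · exact sub_nonneg.2 hsa.le_algebraMap_norm_self
    · exact sub_le_self _ (star_mul_self_nonneg a)
  have h := (Complex.re_le_norm _).trans ((hb _).trans hn)
  have e : (algebraMap ℝ A ‖star a * a‖ : A) = (‖star a * a‖ : ℂ) • (1 : A) := by
    rw [Algebra.algebraMap_eq_smul_one]
    simp
  rw [e, map_sub, map_smul, h1] at h
  simpa using h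

/-- The norm of a self-adjoint element is attained at a state. -/
theorem exists_state_norm_eq [Nontrivial A] (a : selfAdjoint A) :
    ∃ φ : State A, ‖φ.1 (a : A)‖ = ‖a‖ := by
  have ha : IsSelfAdjoint (a : A) := a.2
  have : IsStarNormal (a : A) := ha.isStarNormal
  -- Some spectral value has modulus `‖a‖` and is a character value on the commutative algebra
  -- generated by `a`. A Hahn-Banach extension of that character still has norm at most one and
  -- fixes the unit, so it is a state.
  let E := StarAlgebra.elemental ℂ (a : A)
  let x : E := ⟨a, StarAlgebra.elemental.self_mem ℂ (a : A)⟩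
  have hx : IsSelfAdjoint x := Subtype.ext ha
  obtain ⟨z, hz, hzr⟩ := spectrum.exists_nnnorm_eq_spectralRadius x
  rw [hx.spectralRadius_eq_nnnorm] at hzr
  obtain ⟨χ, hχ⟩ := WeakDual.CharacterSpace.mem_spectrum_iff_exists.1 hz
  let p : Subspace ℂ A := Subalgebra.toSubmodule E.toSubalgebra
  let f : StrongDual ℂ p := WeakDual.toStrongDual (χ : WeakDual ℂ E)
  obtain ⟨g, hg, hgn⟩ := exists_extension_norm_eq p f
  have hχn (y : E) : ‖χ y‖ ≤ ‖y‖ := AlgHom.norm_apply_le_self χ y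
  have hfn : ‖f‖ ≤ 1 := by
    refine ContinuousLinearMap.opNorm_le_bound _ zero_le_one fun y => ?_
    rw [one_mul]
    exact hχn y
  have hg1 : g 1 = 1 := by
    have := hg (1 : E)
    refine this.trans ?_
    exact map_one χ
  refine ⟨⟨StrongDual.toWeakDual g, hg1, nonneg_of_norm_le_one g (hgn ▸ hfn) hg1⟩, ?_⟩
  change ‖g (a : A)‖ = _
  have h := hg x
  have h' : g (a : A) = z := h.trans hχ
  rw [h']
  have : ‖z‖₊ = ‖x‖₊ := by exact_mod_cast hzr
  exact congrArg NNReal.toReal this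

instance [Nontrivial A] : Nonempty (State A) := ⟨(exists_state_norm_eq (0 : selfAdjoint A)).choose⟩

/-- Positivity on `‖a‖1 - a` and `‖a‖1 + a` bounds the real part on both sides and kills the
imaginary part. -/
theorem State.norm_apply_le (φ : State A) (a : selfAdjoint A) : ‖φ.1 (a : A)‖ ≤ ‖a‖ := by
  let _ := CStarAlgebra.spectralOrder A
  have := CStarAlgebra.spectralOrderedRing A
  have ha : IsSelfAdjoint (a : A) := a.2
  have hpos (x : A) (hx : 0 ≤ x) : 0 ≤ φ.1 x := by
    obtain ⟨b, rfl⟩ := CStarAlgebra.nonneg_iff_eq_star_mul_self.1 hx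
    exact φ.2.2 b
  have e : (algebraMap ℝ A ‖(a : A)‖ : A) = (‖(a : A)‖ : ℂ) • (1 : A) := by
    rw [Algebra.algebraMap_eq_smul_one]
    simp
  have h1 := hpos _ (sub_nonneg.2 ha.le_algebraMap_norm_self)
  have h2 := hpos _ (neg_le_iff_add_nonneg.1 ha.neg_algebraMap_norm_le_self)
  rw [e, map_sub, map_smul, φ.2.1, Complex.nonneg_iff] at h1
  rw [e, map_add, map_smul, φ.2.1, Complex.nonneg_iff] at h2
  simp at h1 h2
  have him : (φ.1 (a : A)).im = 0 := by linarith
  have hr : φ.1 (a : A) = ((φ.1 (a : A)).re : ℂ) := Complex.ext rfl (by simpa using him)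
  rw [hr, Complex.norm_real, Real.norm_eq_abs, abs_le]
  change -‖(a : A)‖ ≤ _ ∧ _ ≤ ‖(a : A)‖
  constructor <;> linarith

theorem State.enorm_apply_le (φ : State A) (a : selfAdjoint A) : ‖φ.1 (a : A)‖ₑ ≤ ‖a‖ₑ :=
  enorm_le_iff_norm_le.2 (φ.norm_apply_le a)

theorem enorm_le_of_state [Nontrivial A] {a : selfAdjoint A} {c : ℝ≥0∞}
    (h : ∀ φ : State A, ‖φ.1 (a : A)‖ₑ ≤ c) : ‖a‖ₑ ≤ c := by
  obtain ⟨φ, hφ⟩ := exists_state_norm_eq a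
  exact (enorm_le_iff_norm_le.2 hφ.ge).trans (h φ)

/-- Banach-Alaoglu: the defining conditions are weak* closed, and splitting into real and imaginary
parts gives the crude but sufficient norm bound 2. -/
instance : CompactSpace (State A) := by
  refine isCompact_iff_compactSpace.1 ?_
  refine (WeakDual.isCompact_closedBall (0 : StrongDual ℂ A) 2).of_isClosed_subset ?_ ?_
  · change IsClosed {φ : WeakDual ℂ A | φ 1 = 1 ∧ ∀ a : A, 0 ≤ φ (star a * a)}
    have : {φ : WeakDual ℂ A | φ 1 = 1 ∧ ∀ a : A, 0 ≤ φ (star a * a)} =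
        {φ | φ 1 = 1} ∩ ⋂ a : A, {φ | 0 ≤ φ (star a * a)} := by
      ext
      simp
    rw [this]
    exact (isClosed_eq (WeakDual.eval_continuous 1) continuous_const).inter
      (isClosed_iInter fun a => isClosed_le continuous_const (WeakDual.eval_continuous _))
  · intro φ hφ
    rw [Set.mem_preimage, mem_closedBall_zero_iff]
    refine ContinuousLinearMap.opNorm_le_bound _ zero_le_two fun x => ?_
    change ‖φ x‖ ≤ _
    have h1 := State.norm_apply_le ⟨φ, hφ⟩ (realPart x)
    have h2 := State.norm_apply_le ⟨φ, hφ⟩ (imaginaryPart x)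
    have e : φ x = φ (realPart x : A) + Complex.I * φ (imaginaryPart x : A) := by
      conv_lhs => rw [← realPart_add_I_smul_imaginaryPart x]
      rw [map_add, map_smul, smul_eq_mul]
    rw [e]
    refine (norm_add_le _ _).trans ?_
    rw [norm_mul, Complex.norm_I, one_mul]
    have h3 := realPart.norm_le x
    have h4 := imaginaryPart.norm_le x
    dsimp only at h1 h2
    linarith

end States

/-! ### Lipschitz estimates, total boundedness, and an Arzelà-Ascoli argument. -/

section MongeKantorovich

variable {A B : Type u} [CStarAlgebra A] [CStarAlgebra B] {L : selfAdjoint A → ℝ≥0∞}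

/-- Rescaling by `l⁻¹` reduces to the unit ball of `L`. For `l = 0` the element is a real scalar, on
which all states agree. -/
theorem enorm_sub_le_mul_mkDist (hL : IsLipNorm L) {a : selfAdjoint A} {l : ℝ≥0} (ha : L a ≤ l)
    (φ ψ : State A) : ‖φ.1 (a : A) - ψ.1 (a : A)‖ₑ ≤ l * mkDist L φ ψ := by
  rcases eq_or_ne l 0 with rfl | hl
  · obtain ⟨t, rfl⟩ := (hL.eq_zero_iff a).1 (by simpa using ha)
    have h (χ : State A) : χ.1 ((t • (1 : selfAdjoint A) : selfAdjoint A) : A) = t := by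
      have : ((t • (1 : selfAdjoint A) : selfAdjoint A) : A) = (t : ℂ) • (1 : A) := by simp
      rw [this, map_smul, χ.2.1]
      simp
    rw [h, h ψ]
    simp
  · have hl' : (l : ℝ) ≠ 0 := by exact_mod_cast hl
    have hle : L ((l : ℝ)⁻¹ • a) ≤ 1 := by
      rw [hL.smul]
      have e : ‖(l : ℝ)⁻¹‖ₑ = (l : ℝ≥0∞)⁻¹ := by
        rw [enorm_inv hl']
        simp
      rw [e]
      calc (l : ℝ≥0∞)⁻¹ * L a ≤ (l : ℝ≥0∞)⁻¹ * l := by gcongr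
        _ ≤ 1 := ENNReal.inv_mul_le_one _
    have h := le_iSup₂ (f := fun (a : selfAdjoint A) (_ : L a ≤ 1) =>
      ‖φ.1 (a : A) - ψ.1 (a : A)‖ₑ) _ hle
    have e : a = (l : ℝ) • ((l : ℝ)⁻¹ • a) := by rw [smul_smul, mul_inv_cancel₀ hl', one_smul]
    have e' (χ : State A) : χ.1 (a : A) = (l : ℂ) * χ.1 (((l : ℝ)⁻¹ • a : selfAdjoint A) : A) := by
      have : (a : A) = ((l : ℝ) : ℂ) • (((l : ℝ)⁻¹ • a : selfAdjoint A) : A) := by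
        conv_lhs => rw [e]
        rw [selfAdjoint.val_smul]
        simp
      conv_lhs => rw [this]
      rw [map_smul]
      rfl
    rw [e', e' ψ, ← mul_sub, enorm_mul]
    gcongr
    · simp
    · exact h

theorem mkDist_self (L : selfAdjoint A → ℝ≥0∞) (φ : State A) : mkDist L φ φ = 0 :=
  (mkSpace L).edist_self φ

theorem mkDist_comm (L : selfAdjoint A → ℝ≥0∞) (φ ψ : State A) : mkDist L φ ψ = mkDist L ψ φ :=
  (mkSpace L).edist_comm φ ψ

theorem mkDist_triangle (L : selfAdjoint A → ℝ≥0∞) (φ ψ χ : State A) :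
    mkDist L φ χ ≤ mkDist L φ ψ + mkDist L ψ χ :=
  (mkSpace L).edist_triangle φ ψ χ

theorem isOpen_mkDist_lt (hL : IsLipNorm L) (φ : State A) (ε : ℝ≥0∞) :
    IsOpen {ψ | mkDist L ψ φ < ε} := by
  have h := @Metric.isOpen_eball _ (mkSpace L) φ ε
  rw [hL.metrizes] at h
  exact h

theorem exists_finset_mkDist_lt (hL : IsLipNorm L) {ε : ℝ≥0∞} (hε : 0 < ε) :
    ∃ F : Finset (State A), ∀ φ, ∃ ψ ∈ F, mkDist L φ ψ < ε := by
  obtain ⟨F, -, hF⟩ := isCompact_univ.elim_nhds_subcover (fun φ : State A =>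
    {ψ | mkDist L ψ φ < ε})
    fun φ _ => (isOpen_mkDist_lt hL φ ε).mem_nhds (by simpa [mkDist_self] using hε)
  exact ⟨F, fun φ => by simpa using hF (Set.mem_univ φ)⟩

/-- A finite net at scale 1 turns finiteness of the individual distances into a uniform bound: the
sum over pairs of the net, plus 1 at each end. -/
theorem exists_mkDist_le (hL : IsLipNorm L) : ∃ M : ℝ≥0∞, M < ∞ ∧ ∀ φ ψ, mkDist L φ ψ ≤ M := by
  obtain ⟨F, hF⟩ := exists_finset_mkDist_lt hL one_pos
  have hfin : ∑ φ ∈ F, ∑ ψ ∈ F, mkDist L φ ψ < ∞ :=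
    ENNReal.sum_lt_top.2 fun φ _ => ENNReal.sum_lt_top.2 fun ψ _ => hL.finite φ ψ
  refine ⟨1 + (∑ φ ∈ F, ∑ ψ ∈ F, mkDist L φ ψ + 1), ENNReal.add_lt_top.2
    ⟨ENNReal.one_lt_top, ENNReal.add_lt_top.2 ⟨hfin, ENNReal.one_lt_top⟩⟩, fun φ ψ => ?_⟩
  obtain ⟨φ', hφ', h⟩ := hF φ
  obtain ⟨ψ', hψ', h'⟩ := hF ψ
  rw [mkDist_comm] at h'
  have h3 : mkDist L φ' ψ' ≤ ∑ φ ∈ F, ∑ ψ ∈ F, mkDist L φ ψ :=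
    (Finset.single_le_sum (f := fun ψ => mkDist L φ' ψ) (fun _ _ => zero_le) hψ').trans
      (Finset.single_le_sum (f := fun φ => ∑ ψ ∈ F, mkDist L φ ψ) (fun _ _ => zero_le) hφ')
  exact (mkDist_triangle L φ φ' ψ).trans (add_le_add h.le
    ((mkDist_triangle L φ' ψ' ψ).trans (add_le_add h3 h'.le)))

theorem mkHausdorff_lt_top (hL : IsLipNorm L) {S T : Set (State A)} (hS : S.Nonempty)
    (hT : T.Nonempty) : mkHausdorff L S T < ∞ := by
  obtain ⟨M, hM, h⟩ := exists_mkDist_le hL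
  obtain ⟨s, hs⟩ := hS
  obtain ⟨t, ht⟩ := hT
  exact (@Metric.hausdorffEDist_le_of_mem_edist _ (mkSpace L) S T M
    (fun x _ => ⟨t, ht, h _ _⟩) (fun x _ => ⟨s, hs, h _ _⟩)).trans_lt hM

/-- An evaluation at an element of Lipschitz seminorm at most `l` varies by at most `l` times the
Hausdorff distance. -/
theorem enorm_apply_le_of_mkHausdorff (hL : IsLipNorm L) {S T : Set (State A)}
    (hT : T.Nonempty) {a : selfAdjoint A} {l : ℝ≥0} (ha : L a ≤ l) {c : ℝ≥0∞}
    (hc : ∀ ψ ∈ T, ‖ψ.1 (a : A)‖ₑ ≤ c)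
    {φ : State A} (hφ : φ ∈ S) : ‖φ.1 (a : A)‖ₑ ≤ c + l * mkHausdorff L S T := by
  have h : mkHausdorff L S T ≠ ∞ := (mkHausdorff_lt_top hL ⟨φ, hφ⟩ hT).ne
  refine ENNReal.le_of_forall_pos_le_add fun ε hε _ => ?_
  -- The Hausdorff distance need not be attained, hence the slack; `l + 1` avoids dividing by zero.
  have hlt : mkHausdorff L S T < mkHausdorff L S T + ε / (l + 1) :=
    ENNReal.lt_add_right h (by simpa using hε.ne')
  obtain ⟨ψ, hψ, hd⟩ := @Metric.exists_edist_lt_of_hausdorffEDist_lt _ (mkSpace L) φ S T _ hφ hlt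
  calc ‖φ.1 (a : A)‖ₑ = ‖ψ.1 (a : A) + (φ.1 (a : A) - ψ.1 (a : A))‖ₑ := by rw [add_sub_cancel]
    _ ≤ ‖ψ.1 (a : A)‖ₑ + ‖φ.1 (a : A) - ψ.1 (a : A)‖ₑ := enorm_add_le _ _
    _ ≤ c + l * (mkHausdorff L S T + ε / (l + 1)) := by
      gcongr
      · exact hc ψ hψ
      · exact (enorm_sub_le_mul_mkDist hL ha φ ψ).trans (by gcongr; exact hd.le)
    _ = c + l * mkHausdorff L S T + l * (ε / (l + 1)) := by rw [mul_add, add_assoc]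
    _ ≤ c + l * mkHausdorff L S T + ε := by
      gcongr
      calc (l : ℝ≥0∞) * (ε / (l + 1)) ≤ (l + 1) * (ε / (l + 1)) := by gcongr; exact le_self_add
        _ ≤ ε := ENNReal.mul_div_le

/-- Bounded sets on which a Lip-norm is bounded are relatively compact. -/
theorem cauchy_of_isLipNorm [Nontrivial A] (hL : IsLipNorm L) (f : Ultrafilter (selfAdjoint A))
    {l K : ℝ≥0} (hl : ∀ᶠ a in (f : Filter (selfAdjoint A)), L a ≤ l)
    (hK : ∀ᶠ a in (f : Filter (selfAdjoint A)), ‖a‖ₑ ≤ K) :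
    Cauchy (f : Filter (selfAdjoint A)) := by
  rw [EMetric.cauchy_iff]
  refine ⟨f.neBot.ne, fun ε hε => ?_⟩
  obtain ⟨δ', hδ'0, hδ'ε⟩ := ENNReal.lt_iff_exists_nnreal_btwn.1 hε
  -- Three-epsilon argument: elements with `L ≤ l` are uniformly `l`-Lipschitz on the state space,
  -- so closeness on a finite net of states gives closeness at all states, hence in norm.
  obtain ⟨δ, rfl⟩ : ∃ δ, δ' = δ + δ + δ := ⟨δ' / 3, by ring⟩
  have hδ : 0 < (δ : ℝ≥0∞) := by
    rw [pos_iff_ne_zero]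
    rintro h
    simp [ENNReal.coe_eq_zero.1 h] at hδ'0
  have hε' : 0 < (δ : ℝ≥0∞) / (l + 1) := ENNReal.div_pos hδ.ne' (by simp)
  obtain ⟨F, hF⟩ := exists_finset_mkDist_lt hL hε'
  have hφ (φ : State A) : ∃ s ∈ f, ∀ a ∈ s, ∀ b ∈ s, ‖φ.1 (a : A) - φ.1 (b : A)‖ₑ < δ := by
    have hb : ∀ᶠ a : selfAdjoint A in (f : Filter (selfAdjoint A)),
        φ.1 (a : A) ∈ Metric.closedBall (0 : ℂ) K := hK.mono fun a ha => by
      rw [mem_closedBall_zero_iff]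
      exact (φ.norm_apply_le a).trans (NNReal.coe_le_coe.2 (enorm_le_coe.1 ha))
    -- The values at one state stay in a compact disc, so they converge along the ultrafilter.
    obtain ⟨z, -, hz⟩ := (isCompact_closedBall (0 : ℂ) (K : ℝ)).ultrafilter_le_nhds
      (f.map fun a : selfAdjoint A => φ.1 (a : A)) (le_principal_iff.2 hb)
    have hcau := (cauchy_nhds.mono hz)
    obtain ⟨t, ht, htt⟩ := (EMetric.cauchy_iff.1 hcau).2 δ hδ
    refine ⟨_, ht, fun a ha b hb => ?_⟩
    rw [← edist_eq_enorm_sub]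
    exact htt _ ha _ hb
  choose s hs hsφ using hφ
  refine ⟨(⋂ φ ∈ F, s φ) ∩ {a | L a ≤ l}, inter_mem ((biInter_finset_mem F).2 fun φ _ => hs φ) hl,
    fun a ha b hb => ?_⟩
  rw [edist_eq_enorm_sub a b]
  refine lt_of_le_of_lt (b := (δ + δ + δ : ℝ≥0∞)) (enorm_le_of_state fun φ => ?_) ?_
  · obtain ⟨ψ, hψ, hd⟩ := hF φ
    have key (x : selfAdjoint A) (hx : L x ≤ l) : ‖φ.1 (x : A) - ψ.1 (x : A)‖ₑ ≤ δ := by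
      refine (enorm_sub_le_mul_mkDist hL hx φ ψ).trans ?_
      calc (l : ℝ≥0∞) * mkDist L φ ψ ≤ (l + 1) * (δ / (l + 1)) := by
            gcongr
            exact le_self_add
        _ ≤ δ := ENNReal.mul_div_le
    have ha' := Set.mem_iInter₂.1 ha.1 ψ hψ
    have hb' := Set.mem_iInter₂.1 hb.1 ψ hψ
    calc ‖φ.1 ((a - b : selfAdjoint A) : A)‖ₑ = ‖(φ.1 (a : A) - ψ.1 (a : A)) +
          (ψ.1 (a : A) - ψ.1 (b : A)) - (φ.1 (b : A) - ψ.1 (b : A))‖ₑ := by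
          rw [AddSubgroup.coe_sub, map_sub]
          congr 1
          ring
      _ ≤ ‖(φ.1 (a : A) - ψ.1 (a : A)) + (ψ.1 (a : A) - ψ.1 (b : A))‖ₑ
          + ‖φ.1 (b : A) - ψ.1 (b : A)‖ₑ := enorm_sub_le
      _ ≤ _ := add_le_add ((enorm_add_le _ _).trans
          (add_le_add (key a ha.2) (hsφ ψ a ha' b hb').le)) (key b hb.2)
  · exact_mod_cast hδ'ε

end MongeKantorovich

/-! ### Jordan and Lie products under morphisms, norms and limits. -/

section SaMap

variable {A B : Type u} [CStarAlgebra A] [CStarAlgebra B]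

theorem saMap_add (f : A →⋆ₐ[ℂ] B) (a b : selfAdjoint A) :
    saMap f (a + b) = saMap f a + saMap f b :=
  Subtype.ext (map_add f (a : A) b)

theorem saMap_smul (f : A →⋆ₐ[ℂ] B) (t : ℝ) (a : selfAdjoint A) :
    saMap f (t • a) = t • saMap f a := by
  refine Subtype.ext ?_
  change f (t • (a : A)) = t • f (a : A)
  rw [← Complex.coe_smul, map_smul, Complex.coe_smul]

theorem saMap_one (f : A →⋆ₐ[ℂ] B) : saMap f 1 = 1 :=
  Subtype.ext (map_one f)

theorem saMap_jordan (f : A →⋆ₐ[ℂ] B) (a b : selfAdjoint A) :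
    saMap f (jordan a b) = jordan (saMap f a) (saMap f b) := by
  refine Subtype.ext ?_
  change f ((1 / 2 : ℂ) • ((a : A) * b + b * a)) = (1 / 2 : ℂ) • (f a * f b + f b * f a)
  simp

theorem saMap_lie (f : A →⋆ₐ[ℂ] B) (a b : selfAdjoint A) :
    saMap f (lie a b) = lie (saMap f a) (saMap f b) := by
  refine Subtype.ext ?_
  change f ((1 / (2 * Complex.I) : ℂ) • ((a : A) * b - b * a)) =
    (1 / (2 * Complex.I) : ℂ) • (f a * f b - f b * f a)
  rw [map_smul, map_sub, map_mul, map_mul]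

theorem enorm_saMap_le (f : A →⋆ₐ[ℂ] B) (a : selfAdjoint A) : ‖saMap f a‖ₑ ≤ ‖a‖ₑ :=
  enorm_le_iff_norm_le.2 (NonUnitalStarAlgHom.norm_apply_le f (a : A))

theorem norm_jordan_le (a b : selfAdjoint A) : ‖jordan a b‖ ≤ ‖a‖ * ‖b‖ := by
  change ‖(1 / 2 : ℂ) • ((a : A) * b + b * a)‖ ≤ ‖(a : A)‖ * ‖(b : A)‖
  rw [norm_smul]
  have := norm_add_le ((a : A) * b) (b * a)
  have := norm_mul_le (a : A) b
  have := norm_mul_le (b : A) a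
  have e : ‖(1 / 2 : ℂ)‖ = 1 / 2 := by simp
  rw [e]
  linarith

theorem norm_lie_le (a b : selfAdjoint A) : ‖lie a b‖ ≤ ‖a‖ * ‖b‖ := by
  change ‖(1 / (2 * Complex.I) : ℂ) • ((a : A) * b - b * a)‖ ≤ ‖(a : A)‖ * ‖(b : A)‖
  rw [norm_smul]
  have := norm_sub_le ((a : A) * b) (b * a)
  have := norm_mul_le (a : A) b
  have := norm_mul_le (b : A) a
  have e : ‖(1 / (2 * Complex.I) : ℂ)‖ = 1 / 2 := by simp
  rw [e]
  linarith

theorem enorm_jordan_le (a b : selfAdjoint A) : ‖jordan a b‖ₑ ≤ ‖a‖ₑ * ‖b‖ₑ := by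
  simp only [enorm, ← ENNReal.coe_mul, ENNReal.coe_le_coe]
  exact norm_jordan_le a b

theorem enorm_lie_le (a b : selfAdjoint A) : ‖lie a b‖ₑ ≤ ‖a‖ₑ * ‖b‖ₑ := by
  simp only [enorm, ← ENNReal.coe_mul, ENNReal.coe_le_coe]
  exact norm_lie_le a b

theorem continuous_jordan : Continuous fun p : selfAdjoint A × selfAdjoint A => jordan p.1 p.2 := by
  unfold jordan
  fun_prop

theorem continuous_lie : Continuous fun p : selfAdjoint A × selfAdjoint A => lie p.1 p.2 := by
  unfold lie
  fun_prop

end SaMap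

theorem LeibnizQCMS.L_one (A : LeibnizQCMS.{u}) : A.L 1 = 0 :=
  (A.isLipNorm.eq_zero_iff 1).2 ⟨1, (one_smul ℝ _).symm⟩

/-! ### Lifting through a single tunnel. -/

namespace Tunnel

variable {A B : LeibnizQCMS.{u}}

theorem length_reverse (τ : Tunnel A B) : τ.reverse.length = τ.length := by
  have h1 : τ.reverse.reach = τ.reach :=
    @Metric.hausdorffEDist_comm _ (mkSpace τ.D.L) _ _
  have h2 : τ.reverse.hull = τ.hull := by
    unfold hull
    rw [Set.union_comm]
    rfl
  have h3 : τ.reverse.depth = τ.depth := by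
    unfold depth
    rw [h2]
    rfl
  rw [length, h1, h3, length]

theorem range_union_subset_hull (τ : Tunnel A B) :
    Set.range (State.pullback τ.π₁) ∪ Set.range (State.pullback τ.π₂) ⊆ τ.hull :=
  fun _ hψ => subset_closedConvexHull (Set.mem_image_of_mem (fun ψ : State τ.D => ψ.1) hψ)

theorem hull_nonempty (τ : Tunnel A B) : τ.hull.Nonempty :=
  ⟨_, τ.range_union_subset_hull (Or.inl (Set.mem_range_self (Classical.arbitrary (State A))))⟩

theorem length_lt_top (τ : Tunnel A B) : τ.length < ∞ :=
  max_lt (mkHausdorff_lt_top τ.D.isLipNorm (Set.range_nonempty _) (Set.range_nonempty _))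
    (mkHausdorff_lt_top τ.D.isLipNorm Set.univ_nonempty τ.hull_nonempty)

/-- Both dual maps are onto, so every set entering reach and depth is the whole state space. -/
theorem length_ofIso (h : IsometricIso A B) : (ofIso h).length = 0 := by
  have h1 : Set.range (State.pullback (ofIso h).π₁) = Set.univ :=
    Set.eq_univ_of_forall fun φ => ⟨φ, rfl⟩
  have h2 : Set.range (State.pullback (ofIso h).π₂) = Set.univ := by
    refine Set.eq_univ_of_forall fun φ =>
      ⟨State.pullback (h.symm.toEquiv : B →⋆ₐ[ℂ] A) φ,
        Subtype.ext (ContinuousLinearMap.ext fun a => ?_)⟩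
    exact congrArg φ.1 (h.toEquiv.symm_apply_apply a)
  have h3 : (ofIso h).hull = Set.univ :=
    Set.eq_univ_of_forall fun φ => (ofIso h).range_union_subset_hull (Or.inl (h1 ▸ Set.mem_univ φ))
  have hself (S : Set (State (ofIso h).D)) : mkHausdorff (ofIso h).D.L S S = 0 :=
    @Metric.hausdorffEDist_self _ (mkSpace (ofIso h).D.L) S
  rw [length, reach, depth, h1, h2, h3, hself, max_self]

/-- The elements `a` and `b` have a common lift of Lipschitz seminorm at most `l` and norm at most
`K`. -/
def Target (τ : Tunnel A B) (l K : ℝ≥0) (a : selfAdjoint A) (b : selfAdjoint B) : Prop :=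
  ∃ d : selfAdjoint τ.D, saMap τ.π₁ d = a ∧ saMap τ.π₂ d = b ∧ τ.D.L d ≤ l ∧ ‖d‖ₑ ≤ K

variable {τ : Tunnel A B} {l K l' K' : ℝ≥0} {a a' : selfAdjoint A} {b b' : selfAdjoint B}

theorem Target.reverse (h : τ.Target l K a b) : τ.reverse.Target l K b a := by
  obtain ⟨d, h1, h2, h3⟩ := h
  exact ⟨d, h2, h1, h3⟩

theorem Target.mono (h : τ.Target l K a b) (hK : K ≤ K') : τ.Target l K' a b := by
  obtain ⟨d, h1, h2, h3, h4⟩ := h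
  exact ⟨d, h1, h2, h3, h4.trans (ENNReal.coe_le_coe.2 hK)⟩

theorem Target.add (h : τ.Target l K a b) (h' : τ.Target l' K' a' b') :
    τ.Target (l + l') (K + K') (a + a') (b + b') := by
  obtain ⟨d, rfl, rfl, hl, hK⟩ := h
  obtain ⟨d', rfl, rfl, hl', hK'⟩ := h'
  refine ⟨d + d', saMap_add _ _ _, saMap_add _ _ _, ?_, ?_⟩
  · exact (τ.D.isLipNorm.add_le d d').trans (by push_cast; gcongr)
  · exact (enorm_add_le d d').trans (by push_cast; gcongr)

theorem Target.smul (h : τ.Target l K a b) (t : ℝ) :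
    τ.Target (‖t‖₊ * l) (‖t‖₊ * K) (t • a) (t • b) := by
  obtain ⟨d, rfl, rfl, hl, hK⟩ := h
  refine ⟨t • d, saMap_smul _ _ _, saMap_smul _ _ _, ?_, ?_⟩
  · rw [τ.D.isLipNorm.smul]
    push_cast
    gcongr
    rfl
  · rw [enorm_smul]
    push_cast
    gcongr
    rfl

theorem Target.one : τ.Target 0 1 1 1 := by
  refine ⟨1, saMap_one _, saMap_one _, (τ.D.L_one).le, ?_⟩
  refine enorm_le_of_state fun φ => ?_
  rw [selfAdjoint.val_one, φ.2.1]
  simp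

/-- The Leibniz inequality involves the norms of the lifts, which is why `K` is recorded beside `l`.
-/
theorem Target.jordan (h : τ.Target l K a b) (h' : τ.Target l' K' a' b') :
    τ.Target (K * l' + K' * l) (K * K') (jordan a a') (jordan b b') := by
  obtain ⟨d, rfl, rfl, hl, hK⟩ := h
  obtain ⟨d', rfl, rfl, hl', hK'⟩ := h'
  refine ⟨Propinquity.jordan d d', saMap_jordan _ _ _, saMap_jordan _ _ _, ?_, ?_⟩
  · exact (τ.D.isLeibniz.jordan_le d d' (hl.trans_lt ENNReal.coe_lt_top)
      (hl'.trans_lt ENNReal.coe_lt_top)).trans (by push_cast; gcongr)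
  · exact (enorm_jordan_le d d').trans (by push_cast; gcongr)

theorem Target.lie (h : τ.Target l K a b) (h' : τ.Target l' K' a' b') :
    τ.Target (K * l' + K' * l) (K * K') (lie a a') (lie b b') := by
  obtain ⟨d, rfl, rfl, hl, hK⟩ := h
  obtain ⟨d', rfl, rfl, hl', hK'⟩ := h'
  refine ⟨Propinquity.lie d d', saMap_lie _ _ _, saMap_lie _ _ _, ?_, ?_⟩
  · exact (τ.D.isLeibniz.lie_le d d' (hl.trans_lt ENNReal.coe_lt_top)
      (hl'.trans_lt ENNReal.coe_lt_top)).trans (by push_cast; gcongr)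
  · exact (enorm_lie_le d d').trans (by push_cast; gcongr)

theorem Target.L_le (h : τ.Target l K a b) : B.L b ≤ l := by
  obtain ⟨d, rfl, rfl, hl, hK⟩ := h
  rw [τ.quotient₂]
  exact iInf₂_le_of_le d rfl hl

theorem Target.enorm_le (h : τ.Target l K a b) : ‖b‖ₑ ≤ K := by
  obtain ⟨d, rfl, rfl, hl, hK⟩ := h
  exact (enorm_saMap_le _ _).trans hK

/-- A state pulled back from `B` is, up to arbitrarily small error, within the reach of one pulled
back from `A`, where `d` is bounded by `‖π₁ d‖`. -/
theorem enorm_saMap_π₂_le {d : selfAdjoint τ.D} (hd : τ.D.L d ≤ l) :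
    ‖saMap τ.π₂ d‖ₑ ≤ ‖saMap τ.π₁ d‖ₑ + l * τ.length := by
  refine enorm_le_of_state fun φ => ?_
  have h := enorm_apply_le_of_mkHausdorff τ.D.isLipNorm (Set.range_nonempty (State.pullback τ.π₁))
    hd (c := ‖saMap τ.π₁ d‖ₑ) (by
      rintro _ ⟨ψ, rfl⟩
      exact ψ.enorm_apply_le (saMap τ.π₁ d)) (Set.mem_range_self (f := State.pullback τ.π₂) φ)
  refine le_trans h (add_le_add le_rfl (mul_le_mul le_rfl ?_ zero_le zero_le))
  refine le_trans (le_of_eq ?_) (le_max_left _ _)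
  exact @Metric.hausdorffEDist_comm _ (mkSpace τ.D.L) _ _

theorem Target.enorm_le_add (h : τ.Target l K a b) : ‖b‖ₑ ≤ ‖a‖ₑ + l * τ.length := by
  obtain ⟨d, rfl, rfl, hl, hK⟩ := h
  exact enorm_saMap_π₂_le hl

/-- The reach bounds `d` on both copies of the state spaces, the bound passes to the closed convex
hull because discs are closed and convex, and the depth extends it to all states. Reach and depth
cost `l * τ.length` each, hence the factor 2. -/
theorem enorm_lift_le {d : selfAdjoint τ.D} (hd : τ.D.L d ≤ l) :
    ‖d‖ₑ ≤ ‖saMap τ.π₁ d‖ₑ + 2 * l * τ.length := by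
  refine enorm_le_of_state fun φ => ?_
  have hM : ‖saMap τ.π₁ d‖ₑ + l * τ.length < ∞ :=
    ENNReal.add_lt_top.2 ⟨enorm_lt_top, ENNReal.mul_lt_top ENNReal.coe_lt_top τ.length_lt_top⟩
  have h := enorm_apply_le_of_mkHausdorff τ.D.isLipNorm τ.hull_nonempty
    hd (c := ‖saMap τ.π₁ d‖ₑ + l * τ.length) ?_ (Set.mem_univ φ)
  · refine h.trans ?_
    have : mkHausdorff τ.D.L Set.univ τ.hull ≤ τ.length := le_max_right _ _
    calc _ ≤ ‖saMap τ.π₁ d‖ₑ + l * τ.length + l * τ.length := by gcongr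
      _ = _ := by ring
  · obtain ⟨M, hM'⟩ : ∃ M : ℝ≥0, (M : ℝ≥0∞) = _ := ⟨_, ENNReal.coe_toNNReal hM.ne⟩
    rw [← hM']
    intro ψ hψ
    have hsub : closedConvexHull ℝ ((fun ψ : State τ.D => ψ.1) ''
        (Set.range (State.pullback τ.π₁) ∪ Set.range (State.pullback τ.π₂))) ⊆
        {f : WeakDual ℂ τ.D | f (d : τ.D) ∈ Metric.closedBall (0 : ℂ) M} := by
      refine closedConvexHull_min ?_ ?_ ?_
      · rintro _ ⟨_, hχ, rfl⟩
        refine mem_closedBall_zero_iff.2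
          (NNReal.coe_le_coe.2 (enorm_le_coe.1 (?_ : ‖(_ : ℂ)‖ₑ ≤ _)))
        rw [hM']
        rcases hχ with ⟨χ, rfl⟩ | ⟨χ, rfl⟩
        · exact (χ.enorm_apply_le (saMap τ.π₁ d)).trans le_self_add
        · exact (χ.enorm_apply_le (saMap τ.π₂ d)).trans (enorm_saMap_π₂_le hd)
      · intro f hf g hg s t hs ht hst
        have h := convex_closedBall (0 : ℂ) (M : ℝ) hf hg hs ht hst
        exact h
      · exact Metric.isClosed_closedBall.preimage (WeakDual.eval_continuous (d : τ.D))
    exact enorm_le_coe.2 (NNReal.coe_le_coe.1 (mem_closedBall_zero_iff.1 (hsub hψ)))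

/-- The strict inequality supplies a lift without the infimum being attained, and it is handed on to
`b` so that the construction can be iterated. -/
theorem exists_target (ha : A.L a < l) (hK : ‖a‖ₑ + 2 * l * τ.length ≤ K) :
    ∃ b, τ.Target l K a b ∧ B.L b < l := by
  rw [τ.quotient₁] at ha
  simp only [iInf_lt_iff] at ha
  obtain ⟨d, hd, hl⟩ := ha
  refine ⟨saMap τ.π₂ d, ⟨d, hd, rfl, hl.le, (enorm_lift_le hl.le).trans (by rwa [hd])⟩, ?_⟩
  rw [τ.quotient₂]
  exact lt_of_le_of_lt (iInf₂_le_of_le d rfl le_rfl) hl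

end Tunnel

/-! ### Lifting along journeys. -/

namespace Journey

variable {𝒞 : Set LeibnizQCMS.{u}} {𝒯 : ∀ A B : LeibnizQCMS.{u}, Set (Tunnel A B)}
  {A B E : LeibnizQCMS.{u}}

/-- The concatenation of two journeys. -/
def append : ∀ {A B E : LeibnizQCMS.{u}}, Journey 𝒞 𝒯 A B → Journey 𝒞 𝒯 B E → Journey 𝒞 𝒯 A E
  | _, _, _, .single hA _ τ hτ, Υ' => .cons hA τ hτ Υ'
  | _, _, _, .cons hA τ hτ Υ, Υ' => .cons hA τ hτ (Υ.append Υ')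

theorem length_append : ∀ {A B E : LeibnizQCMS.{u}} (Υ : Journey 𝒞 𝒯 A B) (Υ' : Journey 𝒞 𝒯 B E),
    (Υ.append Υ').length = Υ.length + Υ'.length
  | _, _, _, .single _ _ _ _, _ => rfl
  | _, _, _, .cons _ τ _ Υ, Υ' => by
    change τ.length + (Υ.append Υ').length = τ.length + Υ.length + Υ'.length
    rw [length_append Υ Υ', add_assoc]

theorem exists_reverse (h𝒯 : Compatible 𝒞 𝒯) (Υ : Journey 𝒞 𝒯 A B) :
    ∃ Υ' : Journey 𝒞 𝒯 B A, Υ'.length = Υ.length := by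
  induction Υ with
  | single hA hB τ hτ =>
    exact ⟨.single hB hA τ.reverse (h𝒯.reverse_mem τ hτ), τ.length_reverse⟩
  | cons hA τ hτ Υ ih =>
    obtain ⟨Υ', h⟩ := ih
    refine ⟨Υ'.append (.single (h𝒯.mem_of_mem τ hτ).2 hA τ.reverse (h𝒯.reverse_mem τ hτ)), ?_⟩
    rw [length_append, h, add_comm]
    exact congrArg (· + Υ.length) τ.length_reverse

theorem length_lt_top (Υ : Journey 𝒞 𝒯 A B) : Υ.length < ∞ := by
  induction Υ with
  | single hA hB τ hτ => exact τ.length_lt_top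
  | cons hA τ hτ Υ ih => exact ENNReal.add_lt_top.2 ⟨τ.length_lt_top, ih⟩

/-- The elements `a` and `b` are joined by lifts along the journey, of Lipschitz seminorms at most
`l` and norms at most `K`. -/
def Target (l K : ℝ≥0) :
    ∀ {A B : LeibnizQCMS.{u}}, Journey 𝒞 𝒯 A B → selfAdjoint A → selfAdjoint B → Prop
  | _, _, .single _ _ τ _, a, b => τ.Target l K a b
  | _, _, .cons _ τ _ Υ, a, b => ∃ c, τ.Target l K a c ∧ Υ.Target l K c b

variable {Υ : Journey 𝒞 𝒯 A B} {l K l' K' : ℝ≥0} {a a' : selfAdjoint A} {b b' : selfAdjoint B}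

theorem Target.mono (h : Υ.Target l K a b) (hK : K ≤ K') : Υ.Target l K' a b := by
  induction Υ with
  | single hA hB τ hτ => exact Tunnel.Target.mono h hK
  | cons hA τ hτ Υ ih =>
    obtain ⟨c, h1, h2⟩ := h
    exact ⟨c, h1.mono hK, ih h2⟩

theorem Target.add (h : Υ.Target l K a b) (h' : Υ.Target l' K' a' b') :
    Υ.Target (l + l') (K + K') (a + a') (b + b') := by
  induction Υ with
  | single hA hB τ hτ => exact Tunnel.Target.add h h'
  | cons hA τ hτ Υ ih =>
    obtain ⟨c, h1, h2⟩ := h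
    obtain ⟨c', h1', h2'⟩ := h'
    exact ⟨c + c', h1.add h1', ih h2 h2'⟩

theorem Target.smul (h : Υ.Target l K a b) (t : ℝ) :
    Υ.Target (‖t‖₊ * l) (‖t‖₊ * K) (t • a) (t • b) := by
  induction Υ with
  | single hA hB τ hτ => exact Tunnel.Target.smul h t
  | cons hA τ hτ Υ ih =>
    obtain ⟨c, h1, h2⟩ := h
    exact ⟨t • c, h1.smul t, ih h2⟩

theorem Target.one (Υ : Journey 𝒞 𝒯 A B) : Υ.Target 0 1 1 1 := by
  induction Υ with
  | single hA hB τ hτ => exact Tunnel.Target.one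
  | cons hA τ hτ Υ ih => exact ⟨1, Tunnel.Target.one, ih⟩

theorem Target.jordan (h : Υ.Target l K a b) (h' : Υ.Target l' K' a' b') :
    Υ.Target (K * l' + K' * l) (K * K') (jordan a a') (jordan b b') := by
  induction Υ with
  | single hA hB τ hτ => exact Tunnel.Target.jordan h h'
  | cons hA τ hτ Υ ih =>
    obtain ⟨c, h1, h2⟩ := h
    obtain ⟨c', h1', h2'⟩ := h'
    exact ⟨_, h1.jordan h1', ih h2 h2'⟩

theorem Target.lie (h : Υ.Target l K a b) (h' : Υ.Target l' K' a' b') :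
    Υ.Target (K * l' + K' * l) (K * K') (lie a a') (lie b b') := by
  induction Υ with
  | single hA hB τ hτ => exact Tunnel.Target.lie h h'
  | cons hA τ hτ Υ ih =>
    obtain ⟨c, h1, h2⟩ := h
    obtain ⟨c', h1', h2'⟩ := h'
    exact ⟨_, h1.lie h1', ih h2 h2'⟩

theorem Target.L_right_le (h : Υ.Target l K a b) : B.L b ≤ l := by
  induction Υ with
  | single hA hB τ hτ => exact Tunnel.Target.L_le h
  | cons hA τ hτ Υ ih =>
    obtain ⟨c, h1, h2⟩ := h
    exact ih h2

theorem Target.L_left_le (h : Υ.Target l K a b) : A.L a ≤ l := by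
  cases Υ with
  | single hA hB τ hτ => exact Tunnel.Target.L_le (Tunnel.Target.reverse h)
  | cons hA τ hτ Υ =>
    obtain ⟨c, h1, h2⟩ := h
    exact h1.reverse.L_le

theorem Target.enorm_right_le (h : Υ.Target l K a b) : ‖b‖ₑ ≤ K := by
  induction Υ with
  | single hA hB τ hτ => exact Tunnel.Target.enorm_le h
  | cons hA τ hτ Υ ih =>
    obtain ⟨c, h1, h2⟩ := h
    exact ih h2

theorem Target.enorm_left_le (h : Υ.Target l K a b) : ‖a‖ₑ ≤ K := by
  cases Υ with
  | single hA hB τ hτ => exact Tunnel.Target.enorm_le (Tunnel.Target.reverse h)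
  | cons hA τ hτ Υ =>
    obtain ⟨c, h1, h2⟩ := h
    exact h1.reverse.enorm_le

theorem Target.enorm_right_le_add (h : Υ.Target l K a b) : ‖b‖ₑ ≤ ‖a‖ₑ + l * Υ.length := by
  induction Υ with
  | single hA hB τ hτ => exact Tunnel.Target.enorm_le_add h
  | cons hA τ hτ Υ ih =>
    obtain ⟨c, h1, h2⟩ := h
    calc _ ≤ ‖c‖ₑ + l * Υ.length := ih h2
      _ ≤ ‖_‖ₑ + l * τ.length + l * Υ.length := by gcongr; exact h1.enorm_le_add
      _ = ‖_‖ₑ + l * (τ.length + Υ.length) := by ring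

theorem Target.enorm_left_le_add (h : Υ.Target l K a b) : ‖a‖ₑ ≤ ‖b‖ₑ + l * Υ.length := by
  induction Υ with
  | single hA hB τ hτ =>
    have h' := (Tunnel.Target.reverse h).enorm_le_add
    rwa [Tunnel.length_reverse] at h'
  | cons hA τ hτ Υ ih =>
    obtain ⟨c, h1, h2⟩ := h
    have h1' := h1.reverse.enorm_le_add
    rw [Tunnel.length_reverse] at h1'
    calc _ ≤ ‖c‖ₑ + l * τ.length := h1'
      _ ≤ ‖_‖ₑ + l * Υ.length + l * τ.length := by gcongr; exact ih h2
      _ = ‖_‖ₑ + l * (τ.length + Υ.length) := by ring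

theorem exists_target_right (Υ : Journey 𝒞 𝒯 A B) (ha : A.L a < l)
    (hK : ‖a‖ₑ + 2 * l * Υ.length ≤ K) : ∃ b, Υ.Target l K a b := by
  induction Υ generalizing K with
  | single hA hB τ hτ =>
    obtain ⟨b, hb, -⟩ := Tunnel.exists_target ha hK
    exact ⟨b, hb⟩
  | @cons A B E hA τ hτ Υ ih =>
    have e : ‖a‖ₑ + 2 * l * (τ.length + Υ.length) =
      ‖a‖ₑ + 2 * l * τ.length + 2 * l * Υ.length := by ring
    have hK' : ‖a‖ₑ + 2 * l * τ.length + 2 * l * Υ.length ≤ K := e ▸ hK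
    -- `M` is the norm budget used by the first tunnel alone; the tail consumes the rest of `K`.
    obtain ⟨M, hM⟩ : ∃ M : ℝ≥0, (M : ℝ≥0∞) = _ := ⟨_, ENNReal.coe_toNNReal
      (ne_top_of_le_ne_top ENNReal.coe_ne_top (le_self_add.trans hK'))⟩
    obtain ⟨c, hac, hc⟩ := Tunnel.exists_target ha hM.ge
    rw [← hM] at hK'
    obtain ⟨b, hb⟩ := ih hc ((add_le_add hac.enorm_le le_rfl).trans hK')
    exact ⟨b, c, hac.mono (by exact_mod_cast le_self_add.trans hK'), hb⟩

/-- The induction lifts through the tail first and then through the reversed first tunnel, so the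
strict bound on `A.L a` must be part of the conclusion. Reversing tunnels singly avoids needing the
reversed journey in the class. -/
theorem exists_target_left (Υ : Journey 𝒞 𝒯 A B) (hb : B.L b < l)
    (hK : ‖b‖ₑ + 2 * l * Υ.length ≤ K) : ∃ a, Υ.Target l K a b ∧ A.L a < l := by
  induction Υ generalizing K with
  | single hA hB τ hτ =>
    obtain ⟨a, ha, h⟩ := Tunnel.exists_target (τ := τ.reverse) hb (by rwa [Tunnel.length_reverse])
    exact ⟨a, ha.reverse, h⟩
  | @cons A B E hA τ hτ Υ ih =>
    have e : ‖b‖ₑ + 2 * l * (τ.length + Υ.length) =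
      ‖b‖ₑ + 2 * l * Υ.length + 2 * l * τ.length := by ring
    have hK' : ‖b‖ₑ + 2 * l * Υ.length + 2 * l * τ.length ≤ K := e ▸ hK
    obtain ⟨M, hM⟩ : ∃ M : ℝ≥0, (M : ℝ≥0∞) = _ := ⟨_, ENNReal.coe_toNNReal
      (ne_top_of_le_ne_top ENNReal.coe_ne_top (le_self_add.trans hK'))⟩
    obtain ⟨c, hcb, hc⟩ := ih hb hM.ge
    rw [← hM] at hK'
    obtain ⟨a, ha, h⟩ := Tunnel.exists_target (τ := τ.reverse) hc (K := K) (by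
      rw [Tunnel.length_reverse]
      exact (add_le_add hcb.enorm_left_le le_rfl).trans hK')
    exact ⟨a, ⟨c, ha.reverse, hcb.mono (by exact_mod_cast le_self_add.trans hK')⟩, h⟩

end Journey

/-! ### The full product in terms of Jordan and Lie products. -/

section Parts

variable {A : Type u} [CStarAlgebra A]

theorem mul_eq_jordan_add_lie (a b : selfAdjoint A) :
    (a : A) * b = jordan a b + Complex.I • (lie a b : A) := by
  change _ = (1 / 2 : ℂ) • ((a : A) * b + b * a) +
    Complex.I • (1 / (2 * Complex.I) : ℂ) • ((a : A) * b - b * a)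
  have : Complex.I * (1 / (2 * Complex.I)) = 1 / 2 := by
    field_simp [Complex.I_ne_zero]
  rw [smul_smul, this]
  module

theorem realPart_imaginaryPart_of_eq {x : A} {u v : selfAdjoint A}
    (h : x = u + Complex.I • (v : A)) : realPart x = u ∧ imaginaryPart x = v := by
  subst h
  simp [realPart_I_smul, imaginaryPart_I_smul, selfAdjoint.realPart_coe,
    selfAdjoint.imaginaryPart_coe]

theorem realPart_imaginaryPart_mul (x y : A) :
    realPart (x * y) = jordan (realPart x) (realPart y) - jordan (imaginaryPart x) (imaginaryPart y)
      - lie (realPart x) (imaginaryPart y) - lie (imaginaryPart x) (realPart y) ∧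
    imaginaryPart (x * y) = lie (realPart x) (realPart y) - lie (imaginaryPart x) (imaginaryPart y)
      + jordan (realPart x) (imaginaryPart y) + jordan (imaginaryPart x) (realPart y) := by
  refine realPart_imaginaryPart_of_eq ?_
  conv_lhs => rw [← realPart_add_I_smul_imaginaryPart x, ← realPart_add_I_smul_imaginaryPart y]
  simp only [mul_add, add_mul, smul_mul_assoc, mul_smul_comm, mul_eq_jordan_add_lie,
    AddSubgroup.coe_add, AddSubgroup.coe_sub, smul_add, smul_sub, smul_smul, Complex.I_mul_I,
    neg_smul, one_smul, smul_neg]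
  module

end Parts

/-! ### The limit relation and the isomorphism it defines. -/

section Limit

variable {𝒞 : Set LeibnizQCMS.{u}} {𝒯 : ∀ A B : LeibnizQCMS.{u}, Set (Tunnel A B)}
  {A B : LeibnizQCMS.{u}}

/-- The relation between elements of `A` and `B` which are limits along `U` of elements joined by
the journeys `Υ n`, with uniform bounds. -/
def LimitRel (U : Ultrafilter ℕ) (Υ : ℕ → Journey 𝒞 𝒯 A B) (a : selfAdjoint A)
    (b : selfAdjoint B) : Prop :=
  ∃ l K : ℝ≥0, ∃ (x : ℕ → selfAdjoint A) (y : ℕ → selfAdjoint B),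
    Tendsto x U (𝓝 a) ∧ Tendsto y U (𝓝 b) ∧ ∀ n, (Υ n).Target l K (x n) (y n)

variable {U : Ultrafilter ℕ} {Υ : ℕ → Journey 𝒞 𝒯 A B} {a a' : selfAdjoint A}
  {b b' : selfAdjoint B}

namespace LimitRel

theorem add (h : LimitRel U Υ a b) (h' : LimitRel U Υ a' b') :
    LimitRel U Υ (a + a') (b + b') := by
  obtain ⟨l, K, x, y, hx, hy, ht⟩ := h
  obtain ⟨l', K', x', y', hx', hy', ht'⟩ := h'
  exact ⟨_, _, _, _, hx.add hx', hy.add hy', fun n => (ht n).add (ht' n)⟩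

theorem smul (h : LimitRel U Υ a b) (t : ℝ) : LimitRel U Υ (t • a) (t • b) := by
  obtain ⟨l, K, x, y, hx, hy, ht⟩ := h
  exact ⟨_, _, _, _, hx.const_smul t, hy.const_smul t, fun n => (ht n).smul t⟩

theorem one : LimitRel U Υ 1 1 :=
  ⟨0, 1, _, _, tendsto_const_nhds, tendsto_const_nhds, fun n => .one (Υ n)⟩

theorem zero : LimitRel U Υ 0 0 := by
  simpa using (one (U := U) (Υ := Υ)).smul 0

theorem neg (h : LimitRel U Υ a b) : LimitRel U Υ (-a) (-b) := by
  simpa using h.smul (-1)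

theorem sub (h : LimitRel U Υ a b) (h' : LimitRel U Υ a' b') :
    LimitRel U Υ (a - a') (b - b') := by
  simpa [sub_eq_add_neg] using h.add h'.neg

theorem jordan (h : LimitRel U Υ a b) (h' : LimitRel U Υ a' b') :
    LimitRel U Υ (jordan a a') (jordan b b') := by
  obtain ⟨l, K, x, y, hx, hy, ht⟩ := h
  obtain ⟨l', K', x', y', hx', hy', ht'⟩ := h'
  exact ⟨_, _, _, _, (continuous_jordan.tendsto (a, a')).comp (hx.prodMk_nhds hx'),
    (continuous_jordan.tendsto (b, b')).comp (hy.prodMk_nhds hy'), fun n => (ht n).jordan (ht' n)⟩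

theorem lie (h : LimitRel U Υ a b) (h' : LimitRel U Υ a' b') :
    LimitRel U Υ (lie a a') (lie b b') := by
  obtain ⟨l, K, x, y, hx, hy, ht⟩ := h
  obtain ⟨l', K', x', y', hx', hy', ht'⟩ := h'
  exact ⟨_, _, _, _, (continuous_lie.tendsto (a, a')).comp (hx.prodMk_nhds hx'),
    (continuous_lie.tendsto (b, b')).comp (hy.prodMk_nhds hy'), fun n => (ht n).lie (ht' n)⟩

/-- The bound `l` is common to the whole sequence, so the discrepancy `l * (Υ n).length` tends to
zero. Applied to differences, this gives uniqueness of partners on both sides. -/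
theorem norm_eq (hΥ : Tendsto (fun n => (Υ n).length) U (𝓝 0)) (h : LimitRel U Υ a b) :
    ‖a‖ = ‖b‖ := by
  obtain ⟨l, K, x, y, hx, hy, ht⟩ := h
  have hl : Tendsto (fun n => (l : ℝ≥0∞) * (Υ n).length) U (𝓝 0) := by
    simpa using ENNReal.Tendsto.const_mul hΥ (Or.inr ENNReal.coe_ne_top)
  have h1 := le_of_tendsto_of_tendsto' hx.enorm (hy.enorm.add hl) fun n => (ht n).enorm_left_le_add
  have h2 := le_of_tendsto_of_tendsto' hy.enorm (hx.enorm.add hl) fun n => (ht n).enorm_right_le_add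
  rw [add_zero] at h1 h2
  exact le_antisymm (enorm_le_iff_norm_le.1 h1) (enorm_le_iff_norm_le.1 h2)

theorem right_unique (hΥ : Tendsto (fun n => (Υ n).length) U (𝓝 0)) (h : LimitRel U Υ a b)
    (h' : LimitRel U Υ a b') : b = b' := by
  have := (h.sub h').norm_eq hΥ
  rw [sub_self, norm_zero, eq_comm, norm_eq_zero] at this
  exact sub_eq_zero.1 this

theorem left_unique (hΥ : Tendsto (fun n => (Υ n).length) U (𝓝 0)) (h : LimitRel U Υ a b)
    (h' : LimitRel U Υ a' b) : a = a' := by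
  have := (h.sub h').norm_eq hΥ
  rw [sub_self, norm_zero, norm_eq_zero] at this
  exact sub_eq_zero.1 this

end LimitRel

/-- Along an ultrafilter, a sequence on which the norm and the Lipschitz seminorm are bounded
converges. -/
theorem exists_tendsto_of_L_le (U : Ultrafilter ℕ) {y : ℕ → selfAdjoint B} {l K : ℝ≥0}
    (hl : ∀ n, B.L (y n) ≤ l) (hK : ∀ n, ‖y n‖ₑ ≤ K) :
    ∃ b, Tendsto y U (𝓝 b) ∧ B.L b ≤ l := by
  obtain ⟨b, hb⟩ := CompleteSpace.complete (cauchy_of_isLipNorm B.isLipNorm (U.map y)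
    (Eventually.of_forall hl : ∀ᶠ n in (U : Filter ℕ), B.L (y n) ≤ l)
    (Eventually.of_forall hK : ∀ᶠ n in (U : Filter ℕ), ‖y n‖ₑ ≤ K))
  exact ⟨b, hb, (B.lsc.isClosed_preimage (l : ℝ≥0∞)).mem_of_tendsto hb (Eventually.of_forall hl)⟩

/-- For each `l > A.L a`, compactness yields a partner with seminorm at most `l`. By uniqueness it
does not depend on `l`, so `l` can decrease to `A.L a`. -/
theorem exists_limitRel_right (hΥ : Tendsto (fun n => (Υ n).length) U (𝓝 0))
    (hΥ1 : ∀ n, (Υ n).length ≤ 1) (ha : A.L a < ∞) : ∃ b, LimitRel U Υ a b ∧ B.L b ≤ A.L a := by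
  have key (l : ℝ≥0) (hl : A.L a < l) : ∃ b, LimitRel U Υ a b ∧ B.L b ≤ l := by
    have hK (n : ℕ) : ‖a‖ₑ + 2 * l * (Υ n).length ≤ ((‖a‖₊ + 2 * l : ℝ≥0) : ℝ≥0∞) := by
      push_cast
      refine add_le_add le_rfl ?_
      exact mul_le_of_le_one_right zero_le (hΥ1 n)
    choose y hy using fun n => (Υ n).exists_target_right hl (hK n)
    obtain ⟨b, hb, hbl⟩ := exists_tendsto_of_L_le U (fun n => (hy n).L_right_le)
      fun n => (hy n).enorm_right_le
    exact ⟨b, ⟨_, _, _, _, tendsto_const_nhds, hb, hy⟩, hbl⟩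
  obtain ⟨l, hl, -⟩ := ENNReal.lt_iff_exists_nnreal_btwn.1 ha
  obtain ⟨b, hb, -⟩ := key l hl
  refine ⟨b, hb, le_of_not_gt fun hlt => ?_⟩
  obtain ⟨l', h1, h2⟩ := ENNReal.lt_iff_exists_nnreal_btwn.1 hlt
  obtain ⟨b', hb', hbl⟩ := key l' h1
  exact (hb.right_unique hΥ hb' ▸ h2).not_ge hbl

theorem exists_limitRel_left (hΥ : Tendsto (fun n => (Υ n).length) U (𝓝 0))
    (hΥ1 : ∀ n, (Υ n).length ≤ 1) (hb : B.L b < ∞) : ∃ a, LimitRel U Υ a b ∧ A.L a ≤ B.L b := by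
  have key (l : ℝ≥0) (hl : B.L b < l) : ∃ a, LimitRel U Υ a b ∧ A.L a ≤ l := by
    have hK (n : ℕ) : ‖b‖ₑ + 2 * l * (Υ n).length ≤ ((‖b‖₊ + 2 * l : ℝ≥0) : ℝ≥0∞) := by
      push_cast
      refine add_le_add le_rfl ?_
      exact mul_le_of_le_one_right zero_le (hΥ1 n)
    choose x hx _ using fun n => (Υ n).exists_target_left hl (hK n)
    obtain ⟨a, ha, hal⟩ := exists_tendsto_of_L_le U (fun n => (hx n).L_left_le)
      fun n => (hx n).enorm_left_le
    exact ⟨a, ⟨_, _, _, _, ha, tendsto_const_nhds, hx⟩, hal⟩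
  obtain ⟨l, hl, -⟩ := ENNReal.lt_iff_exists_nnreal_btwn.1 hb
  obtain ⟨a, ha, -⟩ := key l hl
  refine ⟨a, ha, le_of_not_gt fun hlt => ?_⟩
  obtain ⟨l', h1, h2⟩ := ENNReal.lt_iff_exists_nnreal_btwn.1 hlt
  obtain ⟨a', ha', hal⟩ := key l' h1
  exact (ha.left_unique hΥ ha' ▸ h2).not_ge hal

/-- The star subalgebra of `A × B` spanned by the graph of `LimitRel`. -/
noncomputable def limitAlgebra (U : Ultrafilter ℕ) (Υ : ℕ → Journey 𝒞 𝒯 A B) :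
    StarSubalgebra ℂ (A × B) where
  carrier := {p | LimitRel U Υ (realPart p.1) (realPart p.2) ∧
    LimitRel U Υ (imaginaryPart p.1) (imaginaryPart p.2)}
  mul_mem' {p q} hp hq := by
    obtain ⟨h1, h2⟩ := realPart_imaginaryPart_mul p.1 q.1
    obtain ⟨h3, h4⟩ := realPart_imaginaryPart_mul p.2 q.2
    change LimitRel U Υ (realPart (p.1 * q.1)) (realPart (p.2 * q.2)) ∧
      LimitRel U Υ (imaginaryPart (p.1 * q.1)) (imaginaryPart (p.2 * q.2))
    rw [h1, h2, h3, h4]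
    exact ⟨(((hp.1.jordan hq.1).sub (hp.2.jordan hq.2)).sub (hp.1.lie hq.2)).sub (hp.2.lie hq.1),
      (((hp.1.lie hq.1).sub (hp.2.lie hq.2)).add (hp.1.jordan hq.2)).add (hp.2.jordan hq.1)⟩
  add_mem' {p q} hp hq := by
    have h1 := hp.1.add hq.1
    have h2 := hp.2.add hq.2
    simp only [← map_add] at h1 h2
    exact ⟨h1, h2⟩
  algebraMap_mem' z := by
    have e (C : LeibnizQCMS.{u}) : realPart (algebraMap ℂ C z) = z.re • (1 : selfAdjoint C) ∧
        imaginaryPart (algebraMap ℂ C z) = z.im • (1 : selfAdjoint C) := by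
      refine realPart_imaginaryPart_of_eq ?_
      rw [Algebra.algebraMap_eq_smul_one, selfAdjoint.val_smul, selfAdjoint.val_smul,
        selfAdjoint.val_one, ← Complex.coe_smul, ← Complex.coe_smul, smul_smul, ← add_smul,
        mul_comm, Complex.re_add_im]
    change LimitRel U Υ (realPart (algebraMap ℂ A z)) (realPart (algebraMap ℂ B z)) ∧
      LimitRel U Υ (imaginaryPart (algebraMap ℂ A z)) (imaginaryPart (algebraMap ℂ B z))
    rw [(e A).1, (e A).2, (e B).1, (e B).2]
    exact ⟨LimitRel.one.smul _, LimitRel.one.smul _⟩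
  star_mem' {p} hp := by
    have e (C : LeibnizQCMS.{u}) (x : C) : realPart (star x) = realPart x ∧
        imaginaryPart (star x) = - imaginaryPart x := by
      refine realPart_imaginaryPart_of_eq ?_
      conv_lhs => rw [← realPart_add_I_smul_imaginaryPart x]
      simp
    change LimitRel U Υ (realPart (star p.1)) (realPart (star p.2)) ∧
      LimitRel U Υ (imaginaryPart (star p.1)) (imaginaryPart (star p.2))
    rw [(e A _).1, (e A _).2, (e B _).1, (e B _).2]
    exact ⟨hp.1, hp.2.neg⟩

theorem mem_limitAlgebra_iff {p : A × B} : p ∈ limitAlgebra U Υ ↔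
    LimitRel U Υ (realPart p.1) (realPart p.2) ∧
      LimitRel U Υ (imaginaryPart p.1) (imaginaryPart p.2) := Iff.rfl

theorem LimitRel.mem_limitAlgebra (h : LimitRel U Υ a b) :
    ((a : A), (b : B)) ∈ limitAlgebra U Υ := by
  rw [mem_limitAlgebra_iff]
  simpa [selfAdjoint.realPart_coe, selfAdjoint.imaginaryPart_coe] using
    ⟨h, LimitRel.zero⟩

/-- The C*-identity reduces to the self-adjoint element `star q * q`, to which `LimitRel.norm_eq`
applies; continuity extends the equality to the closure. -/
theorem norm_fst_eq_norm_snd (hΥ : Tendsto (fun n => (Υ n).length) U (𝓝 0)) {p : A × B}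
    (hp : p ∈ (limitAlgebra U Υ).topologicalClosure) : ‖p.1‖ = ‖p.2‖ := by
  have hcl : IsClosed {p : A × B | ‖p.1‖ = ‖p.2‖} :=
    isClosed_eq continuous_fst.norm continuous_snd.norm
  refine closure_minimal (fun q hq => ?_) hcl hp
  have h := (mem_limitAlgebra_iff.1 (mul_mem (star_mem hq) hq)).1.norm_eq hΥ
  have e (C : LeibnizQCMS.{u}) (x : C) : ‖realPart (star x * x)‖ = ‖x‖ * ‖x‖ := by
    have hx : (realPart (star x * x) : C) = star x * x :=
      (IsSelfAdjoint.star_mul_self x).coe_realPart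
    rw [← CStarRing.norm_star_mul_self]
    exact congrArg norm hx
  have h' : ‖q.1‖ * ‖q.1‖ = ‖q.2‖ * ‖q.2‖ := by
    rw [← e, ← e]
    exact h
  exact (mul_self_inj (norm_nonneg _) (norm_nonneg _)).1 h'

/-- An isometric *-morphism on a closed star subalgebra whose range contains a
dense set of self-adjoint elements is bijective. -/
theorem bijective_of_isometry {D C : Type u} [CStarAlgebra D] [CStarAlgebra C]
    {G : StarSubalgebra ℂ D} (hG : IsClosed (G : Set D)) (f : G →⋆ₐ[ℂ] C)
    (hf : ∀ x, ‖f x‖ = ‖x‖) {s : Set (selfAdjoint C)} (hs : Dense s)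
    (h : ∀ c ∈ s, (c : C) ∈ Set.range f) : Function.Bijective f := by
  have : CompleteSpace G := hG.completeSpace_coe
  have hiso : Isometry f := AddMonoidHomClass.isometry_of_norm f hf
  -- An isometry from a complete space has closed range, so hitting a dense set of self-adjoint
  -- elements means hitting them all.
  have hcl : IsClosed {c : selfAdjoint C | (c : C) ∈ Set.range f} :=
    hiso.isClosedEmbedding.isClosed_range.preimage continuous_subtype_val
  have hall (c : selfAdjoint C) : (c : C) ∈ f.range :=
    closure_minimal h hcl (hs c)
  refine ⟨hiso.injective, fun c => ?_⟩
  have : c ∈ f.range := by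
    rw [← realPart_add_I_smul_imaginaryPart c]
    exact add_mem (hall _) (SMulMemClass.smul_mem _ (hall _))
  exact this

theorem nonempty_isometricIso_of_tendsto (hΥ : Tendsto (fun n => (Υ n).length) U (𝓝 0))
    (hΥ1 : ∀ n, (Υ n).length ≤ 1) : Nonempty (IsometricIso A B) := by
  let G := (limitAlgebra U Υ).topologicalClosure
  have hG : IsClosed (G : Set (A × B)) := StarSubalgebra.isClosed_topologicalClosure _
  let p : G →⋆ₐ[ℂ] A := (StarAlgHom.fst ℂ A B).comp G.subtype
  let q : G →⋆ₐ[ℂ] B := (StarAlgHom.snd ℂ A B).comp G.subtype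
  have hmem {a : selfAdjoint A} {b : selfAdjoint B} (h : LimitRel U Υ a b) :
      ((a : A), (b : B)) ∈ G := StarSubalgebra.le_topologicalClosure _ h.mem_limitAlgebra
  have hp : Function.Bijective p := by
    refine bijective_of_isometry hG p (fun x => ?_) A.isLipNorm.dense fun a ha => ?_
    -- The product carries the maximum norm, so equality of the two coordinate norms makes the
    -- projection isometric.
    · change ‖x.1.1‖ = max ‖x.1.1‖ ‖x.1.2‖
      rw [← norm_fst_eq_norm_snd hΥ x.2, max_self]
    · obtain ⟨b, hb, -⟩ := exists_limitRel_right hΥ hΥ1 ha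
      exact ⟨⟨_, hmem hb⟩, rfl⟩
  have hq : Function.Bijective q := by
    refine bijective_of_isometry hG q (fun x => ?_) B.isLipNorm.dense fun b hb => ?_
    · change ‖x.1.2‖ = max ‖x.1.1‖ ‖x.1.2‖
      rw [norm_fst_eq_norm_snd hΥ x.2, max_self]
    · obtain ⟨a, ha, -⟩ := exists_limitRel_left hΥ hΥ1 hb
      exact ⟨⟨_, hmem ha⟩, rfl⟩
  let P := StarAlgEquiv.ofBijective p hp
  let Q := StarAlgEquiv.ofBijective q hq
  let h : A ≃⋆ₐ[ℂ] B := P.symm.trans Q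
  have hh {a : selfAdjoint A} {b : selfAdjoint B} (hab : LimitRel U Υ a b) : h a = b := by
    have : P.symm (a : A) = ⟨_, hmem hab⟩ := P.symm_apply_eq.2 rfl
    change Q (P.symm (a : A)) = b
    rw [this]
    rfl
  -- Each inequality is trivial when its right side is infinite; otherwise use the partner of `a`,
  -- respectively the partner of `h a`, which is `a` by injectivity.
  refine ⟨⟨h, fun a => le_antisymm ?_ ?_⟩⟩
  · rcases eq_top_or_lt_top (A.L a) with ha | ha
    · exact ha ▸ le_top
    · obtain ⟨b, hb, hL⟩ := exists_limitRel_right hΥ hΥ1 ha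
      have : saMap (h : A →⋆ₐ[ℂ] B) a = b := Subtype.ext (hh hb)
      rwa [this]
  · rcases eq_top_or_lt_top (B.L (saMap (h : A →⋆ₐ[ℂ] B) a)) with hb | hb
    · exact hb ▸ le_top
    · obtain ⟨a', ha', hL⟩ := exists_limitRel_left hΥ hΥ1 hb
      have : a' = a := Subtype.ext (h.injective (hh ha'))
      rwa [this] at hL

end Limit

/-! ### The metric axioms and the quotient metric. -/

section Metric

variable {𝒞 : Set LeibnizQCMS.{u}} {𝒯 : ∀ A B : LeibnizQCMS.{u}, Set (Tunnel A B)}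
  {A B E : LeibnizQCMS.{u}}

theorem nonempty_isometricIso_of_propinquity_eq_zero (h : propinquity 𝒞 𝒯 A B = 0) :
    Nonempty (IsometricIso A B) := by
  have hex (n : ℕ) : ∃ Υ : Journey 𝒞 𝒯 A B, Υ.length < ((n : ℝ≥0∞) + 1)⁻¹ := by
    refine iInf_lt_iff.1 (lt_of_eq_of_lt h ?_)
    simp
  choose Υ hΥ using hex
  have ht : Tendsto (fun n => (Υ n).length) atTop (𝓝 0) := by
    refine tendsto_of_tendsto_of_tendsto_of_le_of_le tendsto_const_nhds
      ((tendsto_add_atTop_iff_nat 1).2 ENNReal.tendsto_inv_nat_nhds_zero) (fun _ => zero_le)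
      fun n => ?_
    simpa using (hΥ n).le
  -- Any ultrafilter finer than `atTop` serves; the choice of `1 / (n + 1)` also keeps all lengths
  -- at most 1.
  refine nonempty_isometricIso_of_tendsto (U := hyperfilter ℕ) (Υ := Υ)
    (ht.mono_left Nat.hyperfilter_le_atTop) fun n => (hΥ n).le.trans ?_
  rw [ENNReal.inv_le_one]
  exact le_add_self

theorem propinquity_lt_top (h𝒯 : Compatible 𝒞 𝒯) (hA : A ∈ 𝒞) (hB : B ∈ 𝒞) :
    propinquity 𝒞 𝒯 A B < ∞ :=
  let ⟨Υ⟩ := h𝒯.connected A hA B hB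
  (iInf_le _ Υ).trans_lt Υ.length_lt_top

theorem propinquity_comm_le (h𝒯 : Compatible 𝒞 𝒯) : propinquity 𝒞 𝒯 A B ≤ propinquity 𝒞 𝒯 B A :=
  le_iInf fun Υ => let ⟨Υ', h⟩ := Υ.exists_reverse h𝒯
    (iInf_le _ Υ').trans h.le

theorem propinquity_comm (h𝒯 : Compatible 𝒞 𝒯) : propinquity 𝒞 𝒯 A B = propinquity 𝒞 𝒯 B A :=
  le_antisymm (propinquity_comm_le h𝒯) (propinquity_comm_le h𝒯)

theorem propinquity_triangle :
    propinquity 𝒞 𝒯 A B ≤ propinquity 𝒞 𝒯 A E + propinquity 𝒞 𝒯 E B := by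
  refine ENNReal.le_iInf_add_iInf fun Υ Υ' => ?_
  exact (iInf_le _ (Υ.append Υ')).trans (Υ.length_append Υ').le

theorem propinquity_eq_zero_iff (h𝒯 : Compatible 𝒞 𝒯) (hA : A ∈ 𝒞) (hB : B ∈ 𝒞) :
    propinquity 𝒞 𝒯 A B = 0 ↔ Nonempty (IsometricIso A B) := by
  refine ⟨nonempty_isometricIso_of_propinquity_eq_zero, fun ⟨h⟩ => ?_⟩
  refine le_antisymm ?_ zero_le
  exact (iInf_le _ (Journey.single hA hB (Tunnel.ofIso h) (h𝒯.ofIso_mem A hA B hB h).1)).trans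
    (Tunnel.length_ofIso h).le

theorem propinquity_congr (h𝒯 : Compatible 𝒞 𝒯) {A B A' B' : 𝒞}
    (hA : Nonempty (IsometricIso A.1 A'.1)) (hB : Nonempty (IsometricIso B.1 B'.1)) :
    propinquity 𝒞 𝒯 A.1 B.1 = propinquity 𝒞 𝒯 A'.1 B'.1 := by
  have key {A B A' B' : 𝒞} (hA : propinquity 𝒞 𝒯 A.1 A'.1 = 0)
      (hB : propinquity 𝒞 𝒯 B'.1 B.1 = 0) :
      propinquity 𝒞 𝒯 A.1 B.1 ≤ propinquity 𝒞 𝒯 A'.1 B'.1 := by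
    refine (propinquity_triangle (E := A'.1)).trans ?_
    rw [hA, zero_add]
    refine (propinquity_triangle (E := B'.1)).trans ?_
    rw [hB, add_zero]
  have h1 := (propinquity_eq_zero_iff h𝒯 A.2 A'.2).2 hA
  have h2 := (propinquity_eq_zero_iff h𝒯 B.2 B'.2).2 hB
  exact le_antisymm (key h1 (propinquity_comm h𝒯 ▸ h2)) (key (propinquity_comm h𝒯 ▸ h1) h2)

/-- The metric induced by the propinquity on the set of isometric isomorphism classes. -/
@[reducible] noncomputable def propinquityMetric (h𝒯 : Compatible 𝒞 𝒯) :
    MetricSpace (Quotient (isoSetoid 𝒞)) where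
  dist := Quotient.lift₂ (fun A B : 𝒞 => (propinquity 𝒞 𝒯 A.1 B.1).toReal)
    fun _ _ _ _ hA hB => congrArg ENNReal.toReal (propinquity_congr h𝒯 hA hB)
  dist_self := by
    rintro ⟨A⟩
    exact congrArg ENNReal.toReal
      ((propinquity_eq_zero_iff h𝒯 A.2 A.2).2 ⟨IsometricIso.refl A.1⟩)
  dist_comm := by
    rintro ⟨A⟩ ⟨B⟩
    exact congrArg ENNReal.toReal (propinquity_comm h𝒯)
  dist_triangle := by
    rintro ⟨A⟩ ⟨B⟩ ⟨E⟩
    change (propinquity 𝒞 𝒯 A.1 E.1).toReal ≤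
      (propinquity 𝒞 𝒯 A.1 B.1).toReal + (propinquity 𝒞 𝒯 B.1 E.1).toReal
    have h1 := (propinquity_lt_top h𝒯 A.2 B.2).ne
    have h2 := (propinquity_lt_top h𝒯 B.2 E.2).ne
    rw [← ENNReal.toReal_add h1 h2]
    exact ENNReal.toReal_mono (ENNReal.add_ne_top.2 ⟨h1, h2⟩) propinquity_triangle
  eq_of_dist_eq_zero := by
    rintro ⟨A⟩ ⟨B⟩ h
    have h' : (propinquity 𝒞 𝒯 A.1 B.1).toReal = 0 := h
    exact Quotient.sound ((propinquity_eq_zero_iff h𝒯 A.2 B.2).1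
      (((ENNReal.toReal_eq_zero_iff _).1 h').resolve_right (propinquity_lt_top h𝒯 A.2 B.2).ne))

end Metric

end Propinquity

theorem mainTheorem3 (𝒞 : Set Propinquity.LeibnizQCMS.{u}) (h𝒞 : 𝒞.Nonempty)
    (𝒯 : ∀ A B : Propinquity.LeibnizQCMS.{u}, Set (Propinquity.Tunnel A B))
    (h𝒯 : Propinquity.Compatible 𝒞 𝒯) :
    (∀ A₁ ∈ 𝒞, ∀ A₂ ∈ 𝒞, ∀ A₃ ∈ 𝒞,
      Propinquity.propinquity 𝒞 𝒯 A₁ A₂ < ∞ ∧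
      Propinquity.propinquity 𝒞 𝒯 A₁ A₂ = Propinquity.propinquity 𝒞 𝒯 A₂ A₁ ∧
      Propinquity.propinquity 𝒞 𝒯 A₁ A₂ ≤
        Propinquity.propinquity 𝒞 𝒯 A₁ A₃ + Propinquity.propinquity 𝒞 𝒯 A₃ A₂ ∧
      (Propinquity.propinquity 𝒞 𝒯 A₁ A₂ = 0 ↔ Nonempty (Propinquity.IsometricIso A₁ A₂))) ∧
    ∃ m : MetricSpace (Quotient (Propinquity.isoSetoid 𝒞)), ∀ A B : 𝒞,
      ENNReal.ofReal (m.dist (Quotient.mk _ A) (Quotient.mk _ B)) =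
        Propinquity.propinquity 𝒞 𝒯 A.1 B.1 := by
  refine ⟨fun A₁ h₁ A₂ h₂ A₃ h₃ => ⟨Propinquity.propinquity_lt_top h𝒯 h₁ h₂,
    Propinquity.propinquity_comm h𝒯, Propinquity.propinquity_triangle,
    Propinquity.propinquity_eq_zero_iff h𝒯 h₁ h₂⟩, Propinquity.propinquityMetric h𝒯, fun A B => ?_⟩
  exact ENNReal.ofReal_toReal (Propinquity.propinquity_lt_top h𝒯 A.2 B.2).ne
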